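/- A lattice $\Lambda\subset\mathbb R^n$ is the set of all integer linear combinations of linearly independent vectors $B=(b_1,\dots,b_k)$ in $\mathbb R^n$ ($k\ge 1$, not necessarily $k=n$); $\det\Lambda=\sqrt{\det(B^{T}B)}$, and $\Lambda^*=\{y\in\operatorname{span}\Lambda:\langle y,x\rangle\in\mathbb Z\ \forall x\in\Lambda\}$ is the dual lattice. A subspace $W\subseteq\mathbb R^n$ is a lattice subspace of $\Lambda^*$ if it has a basis of vectors of $\Lambda^*$. The covering radius is $\mu(\Lambda)=\inf\{r\ge 0:\operatorname{span}\Lambda\subseteq\Lambda+rB_2^n\}$, where $B_2^n$ is the closed unit Euclidean ball, and the smoothing parameter $\eta(\Lambda)$ is the unique $s>0$ with $\sum_{y\in\Lambda^*}e^{-\pi\|sy\|_2^2}=3/2$. For $n\ge 1$ let $C_\eta(n)$ be the smallest number such that for every lattice $\Lambda\subset\mathbb R^n$ $$\eta(\Lambda)\le C_\eta(n)\max_{W\ne\{0\}\text{ lattice subspace of }\Lambda^*}\det(\Lambda^*\cap W)^{-1/\dim W},$$ and let $C_{KL}(n)$ be the smallest number such that for every lattice $\Lambda\subset\mathbb R^n$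 $$\mu(\Lambda)\le C_{KL}(n)\max_{\substack{W\text{ lattice subspace of }\Lambda^*\\ 1\le d=\dim W\le n}}\frac{\sqrt d}{\det(\Lambda^*\cap W)^{1/d}}.$$ **Theorem.** There is a universal constant $c>0$ such that for all $n\ge 2$ we have $C_{KL}(n)\le c\,\log n\cdot C_\eta(n)$; that is, every lattice $\Lambda\subset\mathbb R^n$ satisfies $$\mu(\Lambda)\le c\,\log n\cdot C_\eta(n)\max_{\substack{W\text{ lattice subspace of }\Lambda^*\\ 1\le d=\dim W\le n}}\frac{\sqrt d}{\det(\Lambda^*\cap W)^{1/d}}.$$ In particular, if $C_\eta(n)\le\operatorname{poly}\log n$ (for $n\ge2$), i.e. the main conjecture holds, then $C_{KL}(n)\le\operatorname{poly}\log n$ (for $n\ge2$), i.e. the $\ell_2$ Kannan–Lovász conjecture holds. -/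

import Mathlib

open scoped ENNReal

noncomputable section

namespace EuclideanLattice

/-- The Euclidean space `ℝⁿ` with the `ℓ₂` norm. -/
abbrev Space (n : ℕ) : Type := EuclideanSpace ℝ (Fin n)

/-- `b` is a basis of the lattice `L`: linearly independent vectors of `ℝⁿ` whose integer linear
combinations are exactly the elements of `L`. -/
def IsBasis {n d : ℕ} (L : Submodule ℤ (Space n)) (b : Fin d → Space n) : Prop :=
  LinearIndependent ℝ b ∧ Submodule.span ℤ (Set.range b) = L

/-- A Euclidean lattice in `ℝⁿ`, of arbitrary rank `d ≤ n`. -/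
def IsLattice {n : ℕ} (L : Submodule ℤ (Space n)) : Prop :=
  ∃ (d : ℕ) (b : Fin d → Space n), IsBasis L b

/-- `√(det (BᵀB))` for the matrix `B` with columns `b i`. -/
def gramVolume {n d : ℕ} (b : Fin d → Space n) : ℝ :=
  Real.sqrt (Matrix.det (Matrix.of fun i j => inner ℝ (b i) (b j)))

/-- The determinant of a lattice, `√(det (BᵀB))` for a basis `B`. The set below has exactly one
element when `L` is a lattice, see `det_eq_gramVolume`. -/
def det {n : ℕ} (L : Submodule ℤ (Space n)) : ℝ :=
  sInf {v : ℝ | ∃ (d : ℕ) (b : Fin d → Space n), IsBasis L b ∧ v = gramVolume b}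

theorem gramVolume_eq_of_isBasis {n d e : ℕ} {L : Submodule ℤ (Space n)}
    {b : Fin d → Space n} {c : Fin e → Space n} (hb : IsBasis L b) (hc : IsBasis L c) :
    gramVolume b = gramVolume c := by
  have key : ∀ {d e : ℕ} {b : Fin d → Space n} {c : Fin e → Space n},
      IsBasis L b → IsBasis L c → ∃ P : Matrix (Fin d) (Fin e) ℤ,
        ∀ i, b i = ∑ j, P i j • c j := by
    intro d e b c hb hc
    have h : ∀ i, ∃ p : Fin e → ℤ, ∑ j, p j • c j = b i := by
      intro i
      have : b i ∈ Submodule.span ℤ (Set.range c) := by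
        rw [hc.2, ← hb.2]
        exact Submodule.subset_span ⟨i, rfl⟩
      exact (Submodule.mem_span_range_iff_exists_fun ℤ).1 this
    choose p hp using h
    exact ⟨p, fun i => (hp i).symm⟩
  have hspan : ∀ {d : ℕ} {b : Fin d → Space n}, IsBasis L b →
      Submodule.span ℝ (Set.range b) = Submodule.span ℝ (L : Set (Space n)) := by
    intro d b hb
    rw [← hb.2, Submodule.span_span_of_tower]
  have hde : d = e := by
    have h1 := finrank_span_eq_card hb.1
    have h2 := finrank_span_eq_card hc.1
    rw [hspan hb] at h1
    rw [hspan hc] at h2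
    simpa using h1.symm.trans h2
  subst hde
  obtain ⟨P, hP⟩ := key hb hc
  obtain ⟨Q, hQ⟩ := key hc hb
  have hli : LinearIndependent ℤ b := hb.1.restrict_scalars (by
    intro x y hxy
    simpa using hxy)
  have hPQ : P * Q = 1 := by
    ext i k
    have h : ∑ k, (P * Q) i k • b k = ∑ k, (1 : Matrix (Fin d) (Fin d) ℤ) i k • b k := by
      have h1 : ∑ k, (1 : Matrix (Fin d) (Fin d) ℤ) i k • b k = b i := by
        simp [Matrix.one_apply]
      rw [h1]
      conv_rhs => rw [hP i]
      simp_rw [Matrix.mul_apply, Finset.sum_smul]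
      rw [Finset.sum_comm]
      refine Finset.sum_congr rfl fun j _ => ?_
      rw [hQ j, Finset.smul_sum]
      simp_rw [mul_smul]
    have h' : ∑ k, ((P * Q) i k - (1 : Matrix (Fin d) (Fin d) ℤ) i k) • b k = 0 := by
      simp_rw [sub_smul, Finset.sum_sub_distrib, h, sub_self]
    have := Fintype.linearIndependent_iff.1 hli _ h' k
    linarith
  have hdet : (P.det : ℝ) * P.det = 1 := by
    have h1 : P.det * Q.det = 1 := by rw [← Matrix.det_mul, hPQ, Matrix.det_one]
    rcases Int.eq_one_or_neg_one_of_mul_eq_one h1 with h | h <;> simp [h]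
  have hgram : (Matrix.of fun i j => inner ℝ (b i) (b j)) =
      (P.map (Int.castRingHom ℝ)) * (Matrix.of fun i j => inner ℝ (c i) (c j)) *
        (P.map (Int.castRingHom ℝ)).transpose := by
    ext i k
    simp only [Matrix.of_apply, Matrix.mul_apply, Matrix.map_apply, Matrix.transpose_apply]
    rw [hP i, hP k, sum_inner]
    simp_rw [inner_sum, Finset.sum_mul]
    rw [Finset.sum_comm]
    refine Finset.sum_congr rfl fun j _ => Finset.sum_congr rfl fun l _ => ?_
    rw [← Int.cast_smul_eq_zsmul ℝ, ← Int.cast_smul_eq_zsmul ℝ, real_inner_smul_left,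
      real_inner_smul_right]
    simp
    ring
  unfold gramVolume
  congr 1
  rw [hgram, Matrix.det_mul, Matrix.det_mul, Matrix.det_transpose]
  have : (P.map (Int.castRingHom ℝ)).det = (P.det : ℝ) := by
    simpa using (RingHom.map_det (Int.castRingHom ℝ) P).symm
  rw [this]
  linear_combination (Matrix.det (Matrix.of fun i j => inner ℝ (c i) (c j))) * hdet

/-- The determinant of a lattice may be computed from any of its bases. -/
theorem det_eq_gramVolume {n d : ℕ} {L : Submodule ℤ (Space n)} {b : Fin d → Space n}
    (hb : IsBasis L b) : det L = gramVolume b := by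
  have : {v : ℝ | ∃ (d : ℕ) (b : Fin d → Space n), IsBasis L b ∧ v = gramVolume b} =
      {gramVolume b} := by
    ext v
    constructor
    · rintro ⟨e, c, hc, rfl⟩
      exact gramVolume_eq_of_isBasis hc hb
    · rintro rfl
      exact ⟨d, b, hb, rfl⟩
  rw [det, this, csInf_singleton]

/-- The dual lattice `L* = {y ∈ span L : ⟨y, x⟩ ∈ ℤ for all x ∈ L}`. -/
def dual {n : ℕ} (L : Submodule ℤ (Space n)) : Submodule ℤ (Space n) where
  carrier := {y | y ∈ Submodule.span ℝ (L : Set (Space n)) ∧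
    ∀ x ∈ L, ∃ k : ℤ, inner ℝ y x = (k : ℝ)}
  zero_mem' := ⟨Submodule.zero_mem _, fun _ _ => ⟨0, by simp⟩⟩
  add_mem' := by
    rintro y z ⟨hy, hy'⟩ ⟨hz, hz'⟩
    refine ⟨Submodule.add_mem _ hy hz, fun x hx => ?_⟩
    obtain ⟨k, hk⟩ := hy' x hx
    obtain ⟨l, hl⟩ := hz' x hx
    exact ⟨k + l, by rw [inner_add_left, hk, hl]; push_cast; rfl⟩
  smul_mem' := by
    rintro m y ⟨hy, hy'⟩
    refine ⟨?_, fun x hx => ?_⟩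
    · rw [← Int.cast_smul_eq_zsmul ℝ]
      exact Submodule.smul_mem _ _ hy
    · obtain ⟨k, hk⟩ := hy' x hx
      exact ⟨m * k, by
        rw [← Int.cast_smul_eq_zsmul ℝ, real_inner_smul_left, hk]; push_cast; rfl⟩

/-- `W` is a lattice subspace of `L` if `W` admits a basis of vectors in `L`. -/
def IsLatticeSubspace {n : ℕ} (L : Submodule ℤ (Space n)) (W : Submodule ℝ (Space n)) : Prop :=
  ∃ b : Module.Basis (Fin (Module.finrank ℝ W)) ℝ W, ∀ i, (b i : Space n) ∈ L

/-- The lattice `L ∩ W`. -/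
def inter {n : ℕ} (L : Submodule ℤ (Space n)) (W : Submodule ℝ (Space n)) :
    Submodule ℤ (Space n) :=
  L ⊓ W.restrictScalars ℤ

/-- The covering radius `μ(L) = inf {r ≥ 0 : span L ⊆ L + r B₂ⁿ}`. -/
def coveringRadius {n : ℕ} (L : Submodule ℤ (Space n)) : ℝ :=
  sInf {r : ℝ | 0 ≤ r ∧ ∀ x ∈ Submodule.span ℝ (L : Set (Space n)), ∃ v ∈ L, ‖x - v‖ ≤ r}

/-- The `ε`-smoothing parameter: the `s > 0` with `∑_{y ∈ L*} exp (-π ‖s y‖²) = 1 + ε`.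
For a nonzero lattice and `ε > 0` there is exactly one such `s`. -/
def smoothingParameterEps {n : ℕ} (ε : ℝ) (L : Submodule ℤ (Space n)) : ℝ :=
  sInf {s : ℝ | 0 < s ∧
    HasSum (fun y : dual L => Real.exp (-Real.pi * ‖s • (y : Space n)‖ ^ 2)) (1 + ε)}

/-- The smoothing parameter `η(L) = η_{1/2}(L)`. -/
def smoothingParameter {n : ℕ} (L : Submodule ℤ (Space n)) : ℝ :=
  smoothingParameterEps (1 / 2) L

/-- The maximum of `det(L* ∩ W)^{-1/dim W}` over the lattice subspaces `W ≠ {0}` of `L*`. -/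
def etaDet {n : ℕ} (L : Submodule ℤ (Space n)) : ℝ≥0∞ :=
  ⨆ (W : Submodule ℝ (Space n)) (_ : IsLatticeSubspace (dual L) W) (_ : W ≠ ⊥),
    ENNReal.ofReal (det (inter (dual L) W) ^ (-(1 / (Module.finrank ℝ W : ℝ))))

/-- The maximum of `√d · det(L* ∩ W)^{-1/d}` over the lattice subspaces `W` of `L*` of dimension
`d ≥ 1`. -/
def muDet {n : ℕ} (L : Submodule ℤ (Space n)) : ℝ≥0∞ :=
  ⨆ (W : Submodule ℝ (Space n)) (_ : IsLatticeSubspace (dual L) W)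
    (_ : 1 ≤ Module.finrank ℝ W),
    ENNReal.ofReal (Real.sqrt (Module.finrank ℝ W) *
      det (inter (dual L) W) ^ (-(1 / (Module.finrank ℝ W : ℝ))))

/-- `C_η(n)`: the smallest `C` with `η(L) ≤ C · max_W det(L* ∩ W)^{-1/dim W}` for every lattice
`L ⊂ ℝⁿ`, as an element of `[0, ∞]`. -/
def Ceta (n : ℕ) : ℝ≥0∞ :=
  sInf {C : ℝ≥0∞ | ∀ L : Submodule ℤ (Space n), IsLattice L → L ≠ ⊥ →
    ENNReal.ofReal (smoothingParameter L) ≤ C * etaDet L}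

/-- `C_KL(n)`: the smallest `C` with `μ(L) ≤ C · max_W √d · det(L* ∩ W)^{-1/d}` for every lattice
`L ⊂ ℝⁿ`, as an element of `[0, ∞]`. -/
def CKL (n : ℕ) : ℝ≥0∞ :=
  sInf {C : ℝ≥0∞ | ∀ L : Submodule ℤ (Space n), IsLattice L → L ≠ ⊥ →
    ENNReal.ofReal (coveringRadius L) ≤ C * muDet L}

/-- `F(n) ≤ poly log n`. -/
def PolylogBounded (F : ℕ → ℝ≥0∞) : Prop :=
  ∃ p : Polynomial ℝ, ∀ n : ℕ, 2 ≤ n → F n ≤ ENNReal.ofReal (p.eval (Real.log n))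

end EuclideanLattice

end

/-!
Write `M` for the dual of the lattice in question and `K` for the maximum of
`√d * det (M ∩ W) ^ (-1 / d)`. At a scale `t`, let `W` be a maximal lattice subspace of `M` with
`t ^ dim W * det (M ∩ W) ≤ 1`, and let `N` be the projection of `M` to `Wᗮ`. Since determinants are
multiplicative along this projection, maximality says that every sublattice `t • (N ∩ V)` has
determinant at least `1`, so the dual of `N ∩ V` has smoothing parameter at most `C_η * t`. By
Poisson summation, its Gaussian sums of widths `s` and `2 * s`, with `s` the smoothing parameter,
are nearly constant; at a point far from all lattice vectors the narrower one would be much smaller,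
so the covering radius is at most `√(dim V) * C_η * t`.

Halving `t` repeatedly, starting from `t = K` and `W = 0`, filters `M` by such subspaces. Covering
radii of the dual pieces add in square, and a subspace `U` found at scale `t / 2` satisfies
`dim U * (t / 2) ^ 2 ≤ K ^ 2`. The step from `W` to `U` therefore contributes
`(dim U - dim W) * (C_η * t) ^ 2`, which is at most `(2 * C_η * K) ^ 2` times the increment of the
harmonic numbers from `dim W` to `dim U`. Telescoping gives the bound `2 * C_η * K * √(1 + log n)`.
-/

noncomputable section

namespace EuclideanLattice

open MeasureTheory Module
open scoped FourierTransform

section Gaussian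

theorem exp_neg_mul_sq_le_inv_pow {a : ℝ} (ha : 0 < a) (m : ℕ) {t : ℝ} (ht : t ≠ 0) :
    Real.exp (-a * t ^ 2) ≤ m.factorial / a ^ m * t⁻¹ ^ (2 * m) := by
  have h := Real.pow_div_factorial_le_exp (a * t ^ 2) (by positivity) m
  rw [neg_mul, Real.exp_neg, pow_mul, inv_pow, inv_pow, ← div_eq_mul_inv, div_div, ← mul_pow,
    ← inv_div]
  exact inv_anti₀ (by positivity) h

theorem exp_neg_mul_norm_add_sq_le {E : Type*} [SeminormedAddCommGroup E] {a : ℝ} (ha : 0 ≤ a)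
    (v x : E) :
    Real.exp (-a * ‖v + x‖ ^ 2) ≤ Real.exp (a * ‖x‖ ^ 2) * Real.exp (-(a / 2) * ‖v‖ ^ 2) := by
  rw [← Real.exp_add, Real.exp_le_exp]
  have h : ‖v‖ ≤ ‖v + x‖ + ‖x‖ := by simpa using norm_sub_le (v + x) x
  have h2 : ‖v‖ ^ 2 ≤ 2 * ‖v + x‖ ^ 2 + 2 * ‖x‖ ^ 2 := by
    nlinarith [sq_nonneg (‖v + x‖ - ‖x‖), norm_nonneg v]
  nlinarith

/-- The periodic Gaussian sum `x ↦ ∑_{v ∈ L} exp (-a ‖v + x‖²)`, which measures how close `x` is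
to `L`. The width is encoded by the coefficient `a` in the exponent. -/
def periodicGaussian {E : Type*} [SeminormedAddCommGroup E] (L : Submodule ℤ E) (a : ℝ) (x : E) :
    ℝ :=
  ∑' v : L, Real.exp (-a * ‖(v : E) + x‖ ^ 2)

variable {E : Type*} [NormedAddCommGroup E] [NormedSpace ℝ E] [FiniteDimensional ℝ E]
  (L : Submodule ℤ E) [DiscreteTopology L] {a : ℝ}

theorem summable_exp_neg_mul_norm_sq (ha : 0 < a) :
    Summable fun v : L => Real.exp (-a * ‖(v : E)‖ ^ 2) := by
  set m := finrank ℤ L + 1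
  refine ((ZLattice.summable_norm_pow_inv L (2 * m) (by omega)).mul_left
    (m.factorial / a ^ m : ℝ)).of_norm_bounded_eventually ?_
  refine (Set.finite_singleton (0 : L)).subset fun v hv => ?_
  by_contra hv0
  refine hv ?_
  change ‖Real.exp (-a * ‖(v : E)‖ ^ 2)‖ ≤ _
  rw [Real.norm_of_nonneg (Real.exp_nonneg _)]
  exact exp_neg_mul_sq_le_inv_pow ha m (by simpa using hv0)

theorem summable_exp_neg_mul_norm_add_sq (ha : 0 < a) (x : E) :
    Summable fun v : L => Real.exp (-a * ‖(v : E) + x‖ ^ 2) :=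
  ((summable_exp_neg_mul_norm_sq L (half_pos ha)).mul_left _).of_nonneg_of_le
    (fun _ => Real.exp_nonneg _) fun v => exp_neg_mul_norm_add_sq_le ha.le (v : E) x

theorem continuous_periodicGaussian (ha : 0 < a) : Continuous (periodicGaussian L a) := by
  refine continuous_iff_continuousAt.2 fun x => ?_
  refine ContinuousOn.continuousAt (s := Metric.ball 0 (‖x‖ + 1)) ?_
    (Metric.isOpen_ball.mem_nhds (by simp))
  refine continuousOn_tsum (u := fun v : L => Real.exp (a * (‖x‖ + 1) ^ 2) *
    Real.exp (-(a / 2) * ‖(v : E)‖ ^ 2)) (fun v => by fun_prop)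
    ((summable_exp_neg_mul_norm_sq L (half_pos ha)).mul_left _) fun v y hy => ?_
  rw [Real.norm_of_nonneg (Real.exp_nonneg _)]
  refine (exp_neg_mul_norm_add_sq_le ha.le _ y).trans ?_
  gcongr
  exact (mem_ball_zero_iff.1 hy).le

theorem periodicGaussian_le_exp_mul {a' R : ℝ} (ha' : 0 < a') (haa' : a' ≤ a) (hR : 0 ≤ R)
    {x : E} (hx : ∀ v ∈ L, R ≤ ‖v + x‖) :
    periodicGaussian L a x ≤ Real.exp (-(a - a') * R ^ 2) * periodicGaussian L a' x := by
  unfold periodicGaussian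
  rw [← tsum_mul_left]
  refine (summable_exp_neg_mul_norm_add_sq L (ha'.trans_le haa') x).tsum_le_tsum (fun v => ?_)
    ((summable_exp_neg_mul_norm_add_sq L ha' x).mul_left _)
  rw [← Real.exp_add, Real.exp_le_exp]
  have hv : R ^ 2 ≤ ‖(v : E) + x‖ ^ 2 := by
    gcongr
    exact hx v v.2
  nlinarith

end Gaussian

section PoissonSummation

theorem mFourier_coe_apply {ι : Type*} [Fintype ι] (k : ι → ℤ) (θ : ι → ℝ) :
    UnitAddTorus.mFourier k (fun i => (θ i : UnitAddCircle)) =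
      Complex.exp (((2 * Real.pi * ∑ i, k i * θ i : ℝ) : ℂ) * Complex.I) := by
  simp only [UnitAddTorus.mFourier, ContinuousMap.coe_mk, fourier_coe_apply, ← Complex.exp_sum]
  congr 1
  push_cast
  rw [Finset.mul_sum, Finset.sum_mul]
  refine Finset.sum_congr rfl fun i _ => ?_
  ring

theorem exists_equivIco_coe_eq_add_intCast (t : ℝ) :
    ∃ m : ℤ, (AddCircle.equivIco 1 0 (t : UnitAddCircle) : ℝ) = t + m := by
  refine ⟨-⌊t⌋, ?_⟩
  rw [AddCircle.coe_equivIco_mk_apply, div_one, mul_one, Int.fract]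
  push_cast
  ring

theorem exists_continuousMap_torus {E X : Type*} [AddCommGroup E] [TopologicalSpace E]
    [IsTopologicalAddGroup E] [T2Space E] [Module ℝ E] [ContinuousSMul ℝ E] [TopologicalSpace X]
    {ι : Type*} [Finite ι] (b : Basis ι ℝ E) {f : E → X} (hf : Continuous f)
    (hper : ∀ x, ∀ v ∈ Submodule.span ℤ (Set.range b), f (x + v) = f x) :
    ∃ F : C(UnitAddTorus ι, X), ∀ θ : ι → ℝ,
      F (fun i => (θ i : UnitAddCircle)) = f (b.equivFun.symm θ) := by
  have := Fintype.ofFinite ι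
  set F : UnitAddTorus ι → X := fun x =>
    f (b.equivFun.symm fun i => (AddCircle.equivIco 1 0 (x i) : ℝ))
  have hF : ∀ θ : ι → ℝ, F (fun i => (θ i : UnitAddCircle)) = f (b.equivFun.symm θ) := by
    intro θ
    choose m hm using fun i => exists_equivIco_coe_eq_add_intCast (θ i)
    have hrep : (b.equivFun.symm fun i => (AddCircle.equivIco 1 0 (θ i : UnitAddCircle) : ℝ)) =
        b.equivFun.symm θ + ∑ i, m i • b i := by
      simp only [hm, Basis.equivFun_symm_apply, add_smul, Finset.sum_add_distrib,
        Int.cast_smul_eq_zsmul]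
    exact (congrArg f hrep).trans <| hper _ _ <| Submodule.sum_mem _ fun i _ =>
      Submodule.smul_mem _ _ (Submodule.subset_span ⟨i, rfl⟩)
  refine ⟨⟨F, ?_⟩, hF⟩
  have hq : IsOpenQuotientMap (Pi.map fun (_ : ι) (t : ℝ) => (t : UnitAddCircle)) :=
    IsOpenQuotientMap.piMap fun _ => QuotientAddGroup.isOpenQuotientMap_mk
  rw [hq.isQuotientMap.continuous_iff]
  have hcomp : F ∘ (Pi.map fun (_ : ι) (t : ℝ) => (t : UnitAddCircle)) =
      fun θ => f (b.equivFun.symm θ) := funext hF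
  rw [hcomp]
  exact hf.comp (LinearMap.continuous_of_finiteDimensional b.equivFun.symm.toLinearMap)

theorem setIntegral_fundamentalDomain_tsum_add {E : Type*} [NormedAddCommGroup E]
    [NormedSpace ℝ E] [MeasurableSpace E] [BorelSpace E] {ι : Type*} [Finite ι] {μ : Measure E}
    [μ.IsAddLeftInvariant] (b : Basis ι ℝ E) {g : E → ℂ} (hg : Integrable g μ) :
    ∫ x in ZSpan.fundamentalDomain b, ∑' v : Submodule.span ℤ (Set.range b), g (v + x) ∂μ =
      ∫ x, g x ∂μ := by
  set L := Submodule.span ℤ (Set.range b)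
  have : VAddInvariantMeasure L E μ := ⟨fun v s _ => measure_preimage_add μ (v : E) s⟩
  have hfund : IsAddFundamentalDomain L _ μ := ZSpan.isAddFundamentalDomain b μ
  rw [hfund.integral_eq_tsum'' g hg, ← integral_tsum]
  · rfl
  · exact fun v => (hg.comp_add_left (v : E)).aestronglyMeasurable.restrict
  · rw [← hfund.lintegral_eq_tsum'' (fun x => ‖g x‖ₑ)]
    exact hg.2.ne

variable {E : Type*} [NormedAddCommGroup E] [InnerProductSpace ℝ E] {ι : Type*} [Fintype ι]

theorem inner_sum_zsmul_eq_of_biorthogonal (b : Basis ι ℝ E) {w : ι → E}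
    (hw : ∀ i x, inner ℝ (w i) x = b.repr x i) (k : ι → ℤ) (x : E) :
    inner ℝ (∑ i, k i • w i) x = ∑ i, k i * b.repr x i := by
  rw [sum_inner]
  refine Finset.sum_congr rfl fun i _ => ?_
  rw [← Int.cast_smul_eq_zsmul ℝ, real_inner_smul_left, hw]

theorem exists_inner_sum_zsmul_eq_intCast (b : Basis ι ℝ E) {w : ι → E}
    (hw : ∀ i x, inner ℝ (w i) x = b.repr x i) (k : ι → ℤ) {v : E}
    (hv : v ∈ Submodule.span ℤ (Set.range b)) :
    ∃ m : ℤ, inner ℝ (∑ i, k i • w i) v = m := by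
  choose p hp using fun i => (b.mem_span_iff_repr_mem ℤ v).1 hv i
  refine ⟨∑ i, k i * p i, ?_⟩
  simp only [inner_sum_zsmul_eq_of_biorthogonal b hw, Int.cast_sum, Int.cast_mul, ← hp]
  rfl

theorem equivFun_symm_preimage_fundamentalDomain {E : Type*} [NormedAddCommGroup E]
    [NormedSpace ℝ E] {ι : Type*} [Finite ι] (b : Basis ι ℝ E) :
    b.equivFun.symm ⁻¹' ZSpan.fundamentalDomain b = Set.univ.pi fun _ => Set.Ico (0 : ℝ) 1 := by
  have := Fintype.ofFinite ι
  ext θ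
  have hcoord (i : ι) : b.repr (b.equivFun.symm θ) i = θ i :=
    congrFun (b.equivFun.apply_symm_apply θ) i
  simp only [Set.mem_preimage, ZSpan.mem_fundamentalDomain, hcoord, Set.mem_univ_pi]

theorem setIntegral_unitCube_eq {E F : Type*} [NormedAddCommGroup E] [NormedSpace ℝ E]
    [MeasurableSpace E] [BorelSpace E] [NormedAddCommGroup F] [NormedSpace ℝ F] [CompleteSpace F]
    (μ : Measure E) [μ.IsAddHaarMeasure] (b : Basis ι ℝ E) (Φ : E → F) :
    ∫ θ in {θ : ι → ℝ | ∀ i, θ i ∈ Set.Ioc (0 : ℝ) (0 + 1)}, Φ (b.equivFun.symm θ) =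
      (μ.real (ZSpan.fundamentalDomain b))⁻¹ • ∫ x in ZSpan.fundamentalDomain b, Φ x ∂μ := by
  have : FiniteDimensional ℝ E := b.finiteDimensional_of_finite
  set e : (ι → ℝ) ≃L[ℝ] E := b.equivFun.symm.toContinuousLinearEquiv
  have : (Measure.map e volume).IsAddHaarMeasure := e.isAddHaarMeasure_map _
  set c := Measure.addHaarScalarFactor (Measure.map e volume) μ
  have hmap : Measure.map e volume = c • μ := Measure.isAddLeftInvariant_eq_smul _ _
  have hIco : e ⁻¹' ZSpan.fundamentalDomain b = Set.univ.pi fun _ => Set.Ico (0 : ℝ) 1 :=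
    equivFun_symm_preimage_fundamentalDomain b
  have hcube : {θ : ι → ℝ | ∀ i, θ i ∈ Set.Ioc (0 : ℝ) (0 + 1)} =ᵐ[volume]
      e ⁻¹' ZSpan.fundamentalDomain b := by
    have hIoc : {θ : ι → ℝ | ∀ i, θ i ∈ Set.Ioc (0 : ℝ) (0 + 1)} =
        Set.univ.pi fun _ : ι => Set.Ioc (0 : ℝ) 1 := by
      simp only [zero_add, ← Set.mem_univ_pi, Set.ofPred_mem_eq]
    rw [hIco, hIoc]
    exact Measure.univ_pi_Ioc_ae_eq_Icc.trans Measure.univ_pi_Ico_ae_eq_Icc.symm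
  have hvol : (c : ℝ) * μ.real (ZSpan.fundamentalDomain b) = 1 := by
    calc (c : ℝ) * μ.real (ZSpan.fundamentalDomain b)
        = (Measure.map e volume).real (ZSpan.fundamentalDomain b) := by
          rw [hmap, measureReal_nnreal_smul_apply]
      _ = (volume : Measure (ι → ℝ)).real (e ⁻¹' ZSpan.fundamentalDomain b) := by
          rw [measureReal_def, measureReal_def]
          exact congrArg _ (e.toHomeomorph.measurableEmbedding.map_apply _ _)
      _ = 1 := by simp [hIco, measureReal_def, Real.volume_pi_Ico]
  rw [setIntegral_congr_set hcube, ← eq_inv_of_mul_eq_one_left hvol]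
  calc ∫ θ in e ⁻¹' ZSpan.fundamentalDomain b, Φ (e θ)
      = ∫ x in ZSpan.fundamentalDomain b, Φ x ∂(Measure.map e volume) :=
        (e.toHomeomorph.measurableEmbedding.setIntegral_map Φ _).symm
    _ = (c : ℝ) • ∫ x in ZSpan.fundamentalDomain b, Φ x ∂μ := by
        rw [hmap, Measure.restrict_smul, integral_smul_nnreal_measure, NNReal.smul_def]

theorem measureReal_fundamentalDomain_pos {E : Type*} [NormedAddCommGroup E] [NormedSpace ℝ E]
    [MeasurableSpace E] [BorelSpace E] (μ : Measure E) [μ.IsAddHaarMeasure] {ι : Type*} [Finite ι]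
    (b : Basis ι ℝ E) : 0 < μ.real (ZSpan.fundamentalDomain b) := by
  have : FiniteDimensional ℝ E := b.finiteDimensional_of_finite
  exact ENNReal.toReal_pos (ZSpan.measure_fundamentalDomain_ne_zero b)
    (ZSpan.fundamentalDomain_isBounded b).measure_lt_top.ne

variable [FiniteDimensional ℝ E] [MeasurableSpace E] [BorelSpace E]

/- The `k`-th Fourier coefficient of the periodization unfolds to an integral over the whole space,
because the character `exp (-2πi ⟨·, ∑ kᵢ wᵢ⟩)` is lattice-periodic. -/
theorem mFourierCoeff_eq_fourier (b : Basis ι ℝ E) {w : ι → E}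
    (hw : ∀ i x, inner ℝ (w i) x = b.repr x i) {f : E → ℂ} (hf : Integrable f)
    {F : C(UnitAddTorus ι, ℂ)} (hF : ∀ θ : ι → ℝ, F (fun i => (θ i : UnitAddCircle)) =
      ∑' v : Submodule.span ℤ (Set.range b), f (v + b.equivFun.symm θ)) (k : ι → ℤ) :
    UnitAddTorus.mFourierCoeff F k =
      (volume.real (ZSpan.fundamentalDomain b) : ℂ)⁻¹ * 𝓕 f (∑ i, k i • w i) := by
  set W := ∑ i, k i • w i with hW
  set χ : E → ℂ := fun y => Complex.exp (((-2 * Real.pi * inner ℝ y W : ℝ) : ℂ) * Complex.I)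
    with hχ
  have hχ_add (v : Submodule.span ℤ (Set.range b)) (y : E) : χ (v + y) = χ y := by
    obtain ⟨m, hm⟩ := exists_inner_sum_zsmul_eq_intCast b hw k v.2
    rw [← hW, real_inner_comm] at hm
    simp only [hχ, inner_add_left, hm]
    refine Complex.exp_eq_exp_iff_exists_int.2 ⟨-m, ?_⟩
    push_cast
    ring
  have hint : Integrable fun y => χ y * f y :=
    hf.bdd_mul (c := 1) (by fun_prop)
      (Filter.Eventually.of_forall fun y => (Complex.norm_exp_ofReal_mul_I _).le)
  have hfourier : 𝓕 f W = ∫ y, χ y * f y := by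
    rw [Real.fourier_eq']
    rfl
  rw [hfourier, ← setIntegral_fundamentalDomain_tsum_add b hint,
    UnitAddTorus.mFourierCoeff_eq_integral F k 0, ← Complex.ofReal_inv, ← Complex.real_smul,
    ← setIntegral_unitCube_eq]
  refine integral_congr_ae (Filter.Eventually.of_forall fun θ => ?_)
  have hcoord (i : ι) : b.repr (b.equivFun.symm θ) i = θ i :=
    congrFun (b.equivFun.apply_symm_apply θ) i
  have hchar : UnitAddTorus.mFourier (-k) (fun i => (θ i : UnitAddCircle)) =
      χ (b.equivFun.symm θ) := by
    have hinner : inner ℝ (b.equivFun.symm θ) W = ∑ i, k i * θ i := by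
      rw [real_inner_comm, hW, inner_sum_zsmul_eq_of_biorthogonal b hw]
      simp only [hcoord]
    simp only [mFourier_coe_apply, hχ, hinner, Pi.neg_apply, Int.cast_neg, neg_mul,
      Finset.sum_neg_distrib, mul_neg]
  simp only [hχ_add, tsum_mul_left, smul_eq_mul, hF, hchar]

theorem hasSum_fourier_mul_exp (b : Basis ι ℝ E) {w : ι → E}
    (hw : ∀ i x, inner ℝ (w i) x = b.repr x i) {f : E → ℂ} (hf : Integrable f)
    (hcont : Continuous fun x => ∑' v : Submodule.span ℤ (Set.range b), f (v + x))
    (hsum : Summable fun k : ι → ℤ => 𝓕 f (∑ i, k i • w i)) (x : E) :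
    HasSum (fun k : ι → ℤ => 𝓕 f (∑ i, k i • w i) *
        Complex.exp (((2 * Real.pi * inner ℝ (∑ i, k i • w i) x : ℝ) : ℂ) * Complex.I))
      (volume.real (ZSpan.fundamentalDomain b) *
        ∑' v : Submodule.span ℤ (Set.range b), f (v + x)) := by
  set V : ℝ := volume.real (ZSpan.fundamentalDomain b)
  have hV : (V : ℂ) ≠ 0 := by
    exact_mod_cast (measureReal_fundamentalDomain_pos volume b).ne'
  obtain ⟨F, hF⟩ := exists_continuousMap_torus b hcont fun x u hu => by
    rw [← (Equiv.addRight (⟨u, hu⟩ : Submodule.span ℤ (Set.range b))).tsum_eq fun v => f (v + x)]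
    refine tsum_congr fun v => ?_
    rw [Equiv.coe_addRight, Submodule.coe_add, add_assoc, add_comm u x]
  have hcoeff := mFourierCoeff_eq_fourier b hw hf hF
  have hS : Summable (UnitAddTorus.mFourierCoeff F) :=
    (hsum.mul_left (V : ℂ)⁻¹).congr fun k => (hcoeff k).symm
  have hseries := (UnitAddTorus.hasSum_mFourier_series_apply_of_summable hS
    fun i => (b.repr x i : UnitAddCircle)).mul_left (V : ℂ)
  rw [hF, show b.equivFun.symm (fun i => b.repr x i) = x from b.equivFun.symm_apply_apply x]
    at hseries
  refine hseries.congr_fun fun k => ?_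
  rw [hcoeff, mFourier_coe_apply, smul_eq_mul, inner_sum_zsmul_eq_of_biorthogonal b hw,
    ← mul_assoc, mul_inv_cancel_left₀ hV]

end PoissonSummation

theorem exp_neg_pi_mul_norm_smul_sq_le {E : Type*} [SeminormedAddCommGroup E]
    [NormedSpace ℝ E] {s t : ℝ} (hs : 0 ≤ s) (hst : s ≤ t) (y : E) :
    Real.exp (-Real.pi * ‖t • y‖ ^ 2) ≤ Real.exp (-Real.pi * ‖s • y‖ ^ 2) := by
  rw [norm_smul, norm_smul, Real.norm_of_nonneg hs, Real.norm_of_nonneg (hs.trans hst), neg_mul,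
    neg_mul]
  gcongr

section Covering

variable {E : Type*} [NormedAddCommGroup E] [InnerProductSpace ℝ E] [FiniteDimensional ℝ E]
  [MeasurableSpace E] [BorelSpace E] {ι : Type*} [Fintype ι]

theorem fourier_exp_neg_pi_div_sq {t : ℝ} (ht : 0 < t) (y : E) :
    𝓕 (fun x : E => (Real.exp (-(Real.pi / t ^ 2) * ‖x‖ ^ 2) : ℂ)) y =
      ((t ^ finrank ℝ E * Real.exp (-Real.pi * ‖t • y‖ ^ 2) : ℝ) : ℂ) := by
  have ha : 0 < Real.pi / t ^ 2 := by positivity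
  have hpow : (Real.pi / (Real.pi / t ^ 2)) ^ ((finrank ℝ E : ℝ) / 2) = t ^ finrank ℝ E := by
    rw [div_div_cancel₀ Real.pi_ne_zero, ← Real.rpow_natCast t 2, ← Real.rpow_mul ht.le,
      Nat.cast_ofNat, mul_div_cancel₀ _ two_ne_zero, Real.rpow_natCast]
  have hexp : -Real.pi ^ 2 * ‖y‖ ^ 2 / (Real.pi / t ^ 2) = -Real.pi * ‖t • y‖ ^ 2 := by
    rw [norm_smul, mul_pow, Real.norm_of_nonneg ht.le]
    field_simp
  have h := fourier_gaussian_innerProductSpace (b := ((Real.pi / t ^ 2 : ℝ) : ℂ)) (V := E)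
    (by simpa only [Complex.ofReal_re] using ha) y
  rw [← hpow, ← hexp, Complex.ofReal_mul, Complex.ofReal_cpow (by positivity), Complex.ofReal_exp]
  push_cast at h ⊢
  exact h

theorem hasSum_periodicGaussian (b : Basis ι ℝ E) {w : ι → E}
    (hw : ∀ i x, inner ℝ (w i) x = b.repr x i) {t : ℝ} (ht : 0 < t)
    (hsum : Summable fun k : ι → ℤ => Real.exp (-Real.pi * ‖t • ∑ i, k i • w i‖ ^ 2)) (x : E) :
    HasSum (fun k : ι → ℤ =>
        ((t ^ finrank ℝ E * Real.exp (-Real.pi * ‖t • ∑ i, k i • w i‖ ^ 2) : ℝ) : ℂ) *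
          Complex.exp (((2 * Real.pi * inner ℝ (∑ i, k i • w i) x : ℝ) : ℂ) * Complex.I))
      ((volume.real (ZSpan.fundamentalDomain b) *
        periodicGaussian (Submodule.span ℤ (Set.range b)) (Real.pi / t ^ 2) x : ℝ) : ℂ) := by
  have ha : 0 < Real.pi / t ^ 2 := by positivity
  set f : E → ℂ := fun x => Real.exp (-(Real.pi / t ^ 2) * ‖x‖ ^ 2)
  have hf : Integrable f := by
    have h := GaussianFourier.integrable_cexp_neg_mul_sq_norm_add
      (b := ((Real.pi / t ^ 2 : ℝ) : ℂ)) (V := E) (by simpa only [Complex.ofReal_re] using ha) 0 0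
    simpa [f] using h
  have htsum (y : E) : ∑' v : Submodule.span ℤ (Set.range b), f (v + y) =
      (periodicGaussian (Submodule.span ℤ (Set.range b)) (Real.pi / t ^ 2) y : ℂ) :=
    (Complex.ofReal_tsum _).symm
  have h𝓕 (y : E) := fourier_exp_neg_pi_div_sq ht y
  have h := hasSum_fourier_mul_exp b hw hf ?_ ?_ x
  · simp only [htsum, f, h𝓕] at h
    exact_mod_cast h
  · simp only [htsum]
    exact Complex.continuous_ofReal.comp (continuous_periodicGaussian _ ha)
  · simp only [f, h𝓕]
    exact Complex.ofRealCLM.summable (hsum.mul_left _)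

theorem abs_sub_le_of_hasSum_mul {κ : Type*} {c S T : ℝ} {u : κ → ℝ} {z : κ → ℂ} {i₀ : κ}
    (hc : 0 ≤ c) (hu : ∀ i, 0 ≤ u i) (hz : ∀ i, ‖z i‖ = 1) (hu₀ : u i₀ = 1) (hz₀ : z i₀ = 1)
    (hS : HasSum u S) (hT : HasSum (fun i => ((c * u i : ℝ) : ℂ) * z i) (T : ℂ)) :
    |T - c| ≤ c * (S - 1) := by
  classical
  have hT' := hT.update i₀ 0
  have hS' := (hS.update i₀ 0).mul_left c
  rw [hu₀] at hS'
  rw [hu₀, hz₀] at hT'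
  have hle := tsum_of_norm_bounded hS' (f := Function.update
    (fun i => ((c * u i : ℝ) : ℂ) * z i) i₀ 0) fun i => ?_
  · have hcast : (0 - ((c * 1 : ℝ) : ℂ) * 1 + (T : ℂ)) = ((T - c : ℝ) : ℂ) := by
      push_cast
      ring
    rw [hT'.tsum_eq, hcast, Complex.norm_real, Real.norm_eq_abs] at hle
    linarith
  · rcases eq_or_ne i i₀ with rfl | hi
    · simp
    · simp [hi, hz, abs_of_nonneg hc, abs_of_nonneg (hu i)]

theorem abs_volume_mul_periodicGaussian_sub_le (b : Basis ι ℝ E) {w : ι → E}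
    (hw : ∀ i x, inner ℝ (w i) x = b.repr x i) {t S : ℝ} (ht : 0 < t)
    (hS : HasSum (fun k : ι → ℤ => Real.exp (-Real.pi * ‖t • ∑ i, k i • w i‖ ^ 2)) S) (x : E) :
    |volume.real (ZSpan.fundamentalDomain b) *
        periodicGaussian (Submodule.span ℤ (Set.range b)) (Real.pi / t ^ 2) x -
      t ^ finrank ℝ E| ≤ t ^ finrank ℝ E * (S - 1) :=
  abs_sub_le_of_hasSum_mul (i₀ := 0) (by positivity) (fun _ => Real.exp_nonneg _)
    (fun _ => Complex.norm_exp_ofReal_mul_I _) (by simp) (by simp) hS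
    (hasSum_periodicGaussian b hw ht hS.summable x)

theorem three_mul_two_pow_lt_exp {d : ℕ} (hd : d ≠ 0) :
    3 * 2 ^ d < Real.exp (3 * Real.pi / 4 * d) := by
  have hsix : 6 < Real.exp (3 * Real.pi / 4) := by
    calc (6 : ℝ) ≤ Real.exp 1 * Real.exp 1 := by nlinarith [Real.exp_one_gt_d9]
      _ = Real.exp 2 := by rw [← Real.exp_add]; norm_num
      _ < Real.exp (3 * Real.pi / 4) := by
        rw [Real.exp_lt_exp]
        linarith [Real.pi_gt_three]
  calc (3 : ℝ) * 2 ^ d ≤ 3 ^ d * 2 ^ d := by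
        gcongr
        exact le_self_pow₀ (by norm_num) hd
    _ = 6 ^ d := by rw [← mul_pow]; norm_num
    _ < Real.exp (3 * Real.pi / 4) ^ d := by gcongr
    _ = Real.exp (3 * Real.pi / 4 * d) := by rw [← Real.exp_nat_mul, mul_comm]

theorem periodicGaussian_two_mul_le (b : Basis ι ℝ E) {w : ι → E}
    (hw : ∀ i x, inner ℝ (w i) x = b.repr x i) {s S : ℝ} (hs : 0 < s) (hS : S ≤ 3 / 2)
    (hsum : HasSum (fun k : ι → ℤ => Real.exp (-Real.pi * ‖s • ∑ i, k i • w i‖ ^ 2)) S) (x : E) :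
    periodicGaussian (Submodule.span ℤ (Set.range b)) (Real.pi / (2 * s) ^ 2) x ≤
      3 * 2 ^ finrank ℝ E *
        periodicGaussian (Submodule.span ℤ (Set.range b)) (Real.pi / s ^ 2) x := by
  have hle (k : ι → ℤ) : Real.exp (-Real.pi * ‖(2 * s) • ∑ i, k i • w i‖ ^ 2) ≤
      Real.exp (-Real.pi * ‖s • ∑ i, k i • w i‖ ^ 2) :=
    exp_neg_pi_mul_norm_smul_sq_le hs.le (by linarith) _
  have hsum₂ := (hsum.summable.of_nonneg_of_le (fun _ => Real.exp_nonneg _) hle).hasSum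
  have hS₂ := (hasSum_le hle hsum₂ hsum).trans hS
  have hlower := (abs_le.1 (abs_volume_mul_periodicGaussian_sub_le b hw hs hsum x)).1
  have hupper := (abs_le.1 (abs_volume_mul_periodicGaussian_sub_le b hw (by positivity) hsum₂ x)).2
  rw [mul_pow 2 s (finrank ℝ E)] at hupper
  have hsd : 0 < s ^ finrank ℝ E := by positivity
  have h2sd : 0 < 2 ^ finrank ℝ E * s ^ finrank ℝ E := by positivity
  refine le_of_mul_le_mul_left ?_ (measureReal_fundamentalDomain_pos volume b)
  calc _ ≤ 2 ^ finrank ℝ E * s ^ finrank ℝ E * (3 / 2) := by nlinarith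
    _ = 3 * 2 ^ finrank ℝ E * (s ^ finrank ℝ E / 2) := by ring
    _ ≤ 3 * 2 ^ finrank ℝ E * (volume.real (ZSpan.fundamentalDomain b) * _) := by
        gcongr
        nlinarith
    _ = _ := mul_left_comm _ _ _

/- By smoothness at scale `s`, the Gaussian sums of widths `s` and `2s` at `-x` are comparable,
whereas a point farther than `√d s` from the lattice would lose a factor `exp (-3πd/4)` when
passing from width `2s` to width `s`. -/
theorem exists_mem_norm_add_le (b : Basis ι ℝ E) {w : ι → E}
    (hw : ∀ i x, inner ℝ (w i) x = b.repr x i) {s S : ℝ} (hs : 0 < s) (hS : S ≤ 3 / 2)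
    (hsum : HasSum (fun k : ι → ℤ => Real.exp (-Real.pi * ‖s • ∑ i, k i • w i‖ ^ 2)) S) (x : E) :
    ∃ v ∈ Submodule.span ℤ (Set.range b), ‖v + x‖ ≤ √(finrank ℝ E) * s := by
  set d := finrank ℝ E
  set L := Submodule.span ℤ (Set.range b)
  rcases eq_or_ne d 0 with hd₀ | hd₀
  · have : Subsingleton E := finrank_zero_iff.1 hd₀
    exact ⟨0, L.zero_mem, by simp [Subsingleton.elim x 0, hd₀]⟩
  by_contra! hfar
  have hdecay : periodicGaussian L (Real.pi / s ^ 2) x ≤ Real.exp (-(3 * Real.pi / 4 * d)) *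
      periodicGaussian L (Real.pi / (2 * s) ^ 2) x := by
    have h := periodicGaussian_le_exp_mul L (a' := Real.pi / (2 * s) ^ 2) (a := Real.pi / s ^ 2)
      (by positivity) (by gcongr; linarith) (by positivity) fun v hv => (hfar v hv).le
    have hexp : -(Real.pi / s ^ 2 - Real.pi / (2 * s) ^ 2) * (√d * s) ^ 2 =
        -(3 * Real.pi / 4 * d) := by
      rw [mul_pow (√d), Real.sq_sqrt d.cast_nonneg]
      field_simp
      ring
    rwa [hexp] at h
  have hpos : 0 < periodicGaussian L (Real.pi / s ^ 2) x :=
    (summable_exp_neg_mul_norm_add_sq L (by positivity) x).tsum_pos (fun _ => Real.exp_nonneg _) 0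
      (Real.exp_pos _)
  refine (three_mul_two_pow_lt_exp hd₀).not_ge (le_of_mul_le_mul_right ?_ hpos)
  rw [Real.exp_neg, inv_mul_eq_div, le_div_iff₀' (Real.exp_pos _)] at hdecay
  exact hdecay.trans (periodicGaussian_two_mul_le b hw hs hS hsum x)

end Covering

section Smoothing

variable {E : Type*} [NormedAddCommGroup E] [NormedSpace ℝ E] [FiniteDimensional ℝ E]
  (M : Submodule ℤ E) [DiscreteTopology M]

theorem summable_exp_neg_pi_mul_norm_smul_sq {s : ℝ} (hs : 0 < s) :
    Summable fun y : M => Real.exp (-Real.pi * ‖s • (y : E)‖ ^ 2) := by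
  refine (summable_exp_neg_mul_norm_sq M (a := Real.pi * s ^ 2) (by positivity)).congr fun y => ?_
  rw [norm_smul, mul_pow, Real.norm_of_nonneg hs.le]
  ring_nf

theorem continuousOn_tsum_exp_neg_pi_mul_norm_smul_sq :
    ContinuousOn (fun s : ℝ => ∑' y : M, Real.exp (-Real.pi * ‖s • (y : E)‖ ^ 2))
      (Set.Ioi 0) := by
  intro s₀ hs₀
  have hs₀ : 0 < s₀ := hs₀
  refine (ContinuousOn.continuousAt (s := Set.Ioi (s₀ / 2)) ?_
    (isOpen_Ioi.mem_nhds (half_lt_self hs₀))).continuousWithinAt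
  refine continuousOn_tsum (fun y => by fun_prop)
    (summable_exp_neg_pi_mul_norm_smul_sq M (half_pos hs₀)) fun y s hs => ?_
  rw [Real.norm_of_nonneg (Real.exp_nonneg _)]
  exact exp_neg_pi_mul_norm_smul_sq_le (half_pos hs₀).le (le_of_lt hs) _

theorem tendsto_tsum_exp_neg_pi_mul_norm_smul_sq :
    Filter.Tendsto (fun s : ℝ => ∑' y : M, Real.exp (-Real.pi * ‖s • (y : E)‖ ^ 2)) Filter.atTop
      (nhds 1) := by
  classical
  rw [← tsum_ite_eq (0 : M) fun _ => (1 : ℝ)]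
  refine tendsto_tsum_of_dominated_convergence (summable_exp_neg_pi_mul_norm_smul_sq M one_pos)
    (fun y => ?_) ?_
  · rcases eq_or_ne y 0 with rfl | hy
    · simp
    · have hy' : 0 < ‖(y : E)‖ := by simpa using hy
      simp only [if_neg hy, norm_smul, neg_mul]
      refine Real.tendsto_exp_neg_atTop_nhds_zero.comp ?_
      refine Filter.Tendsto.const_mul_atTop Real.pi_pos
        ((Filter.tendsto_pow_atTop two_ne_zero).comp ?_)
      exact (tendsto_norm_atTop_atTop).atTop_mul_const hy'
  · filter_upwards [Filter.eventually_ge_atTop 1] with s hs y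
    rw [Real.norm_of_nonneg (Real.exp_nonneg _)]
    exact exp_neg_pi_mul_norm_smul_sq_le zero_le_one hs _

theorem exists_lt_tsum_exp_neg_pi_mul_norm_smul_sq (hM : M ≠ ⊥) (A : ℝ) :
    ∃ s : ℝ, 0 < s ∧ A < ∑' y : M, Real.exp (-Real.pi * ‖s • (y : E)‖ ^ 2) := by
  obtain ⟨u, hu⟩ := M.exists_mem_ne_zero_of_ne_bot hM
  have : Infinite M := .of_injective (fun k : ℤ => k • (⟨u, hu.1⟩ : M))
    (smul_left_injective ℤ (by simpa using hu.2))
  obtain ⟨N, hN⟩ := exists_nat_gt A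
  obtain ⟨T, rfl⟩ := Infinite.exists_subset_card_eq M N
  have htendsto : Filter.Tendsto
      (fun s : ℝ => ∑ y ∈ T, Real.exp (-Real.pi * ‖s • (y : E)‖ ^ 2))
      (nhdsWithin 0 (Set.Ioi 0)) (nhds (T.card : ℝ)) := by
    have hcont : Continuous fun s : ℝ => ∑ y ∈ T, Real.exp (-Real.pi * ‖s • (y : E)‖ ^ 2) := by
      fun_prop
    simpa using (hcont.tendsto 0).mono_left nhdsWithin_le_nhds
  obtain ⟨s, hAs, hs⟩ := ((htendsto.eventually_const_lt hN).and self_mem_nhdsWithin).exists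
  exact ⟨s, hs, hAs.trans_le ((summable_exp_neg_pi_mul_norm_smul_sq M hs).sum_le_tsum T
    fun _ _ => Real.exp_nonneg _)⟩

theorem strictAntiOn_tsum_exp_neg_pi_mul_norm_smul_sq (hM : M ≠ ⊥) :
    StrictAntiOn (fun s : ℝ => ∑' y : M, Real.exp (-Real.pi * ‖s • (y : E)‖ ^ 2))
      (Set.Ioi 0) := by
  obtain ⟨u, huM, hu⟩ := M.exists_mem_ne_zero_of_ne_bot hM
  intro s hs t ht hst
  have hs : 0 < s := hs
  refine (summable_exp_neg_pi_mul_norm_smul_sq M ht).tsum_lt_tsum (i := ⟨u, huM⟩)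
    (fun y => exp_neg_pi_mul_norm_smul_sq_le hs.le hst.le _) ?_
    (summable_exp_neg_pi_mul_norm_smul_sq M hs)
  have : 0 < ‖u‖ := norm_pos_iff.2 hu
  rw [norm_smul, norm_smul, Real.norm_of_nonneg hs.le, Real.norm_of_nonneg (hs.trans hst).le,
    neg_mul, neg_mul]
  gcongr

theorem existsUnique_hasSum_exp_neg_pi_mul_norm_smul_sq (hM : M ≠ ⊥) {ε : ℝ} (hε : 0 < ε) :
    ∃! s : ℝ, 0 < s ∧ HasSum (fun y : M => Real.exp (-Real.pi * ‖s • (y : E)‖ ^ 2)) (1 + ε) := by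
  obtain ⟨s₁, hs₁, hlt₁⟩ := exists_lt_tsum_exp_neg_pi_mul_norm_smul_sq M hM (1 + ε)
  obtain ⟨s₂, hlt₂, hs₁₂⟩ := ((tendsto_tsum_exp_neg_pi_mul_norm_smul_sq M).eventually_lt_const
    (lt_add_of_pos_right 1 hε)).and (Filter.eventually_ge_atTop s₁) |>.exists
  obtain ⟨s, hs, heq⟩ := intermediate_value_Icc' hs₁₂
    ((continuousOn_tsum_exp_neg_pi_mul_norm_smul_sq M).mono fun _ h => hs₁.trans_le h.1)
    ⟨hlt₂.le, hlt₁.le⟩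
  have hs₀ : 0 < s := hs₁.trans_le hs.1
  refine ⟨s, ⟨hs₀, heq ▸ (summable_exp_neg_pi_mul_norm_smul_sq M hs₀).hasSum⟩, ?_⟩
  rintro t ⟨ht, hsum⟩
  exact (strictAntiOn_tsum_exp_neg_pi_mul_norm_smul_sq M hM).injOn ht hs₀
    (hsum.tsum_eq.trans heq.symm)

end Smoothing

/-- The real span of a lattice, the space whose dimension is the rank. -/
abbrev realSpan {n : ℕ} (L : Submodule ℤ (Space n)) : Submodule ℝ (Space n) :=
  Submodule.span ℝ (L : Set (Space n))

section DualBasis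

variable {E : Type*} [NormedAddCommGroup E] [InnerProductSpace ℝ E]

theorem eq_zero_of_mem_span_of_inner_eq_zero {s : Set E} {z : E}
    (hz : z ∈ Submodule.span ℝ s) (h : ∀ x ∈ s, inner ℝ z x = 0) : z = 0 := by
  have hle : Submodule.span ℝ s ≤ (ℝ ∙ z)ᗮ :=
    Submodule.span_le.2 fun x hx => Submodule.mem_orthogonal_singleton_iff_inner_right.2 (h x hx)
  exact inner_self_eq_zero.1 (Submodule.mem_orthogonal_singleton_iff_inner_right.1 (hle hz))

variable {ι : Type*} [DecidableEq ι] {b w : ι → E}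

theorem exists_biorthogonal [Finite ι] (hb : LinearIndependent ℝ b) :
    ∃ w : ι → E, (∀ i, w i ∈ Submodule.span ℝ (Set.range b)) ∧
      ∀ i j, inner ℝ (w i) (b j) = if i = j then 1 else 0 := by
  have : FiniteDimensional ℝ (Submodule.span ℝ (Set.range b)) :=
    FiniteDimensional.span_of_finite ℝ (Set.finite_range b)
  set B := Basis.span hb
  refine ⟨fun i => ((InnerProductSpace.toDual ℝ _).symm
    (LinearMap.toContinuousLinearMap (B.coord i)) : Submodule.span ℝ (Set.range b)),
    fun i => Submodule.coe_mem _, fun i j => ?_⟩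
  have hj : b j = (B j : E) := by rw [Basis.span_apply]
  rw [hj, ← Submodule.coe_inner, InnerProductSpace.toDual_symm_apply]
  simp [Finsupp.single_apply, eq_comm]

theorem biorthogonal_symm (h : ∀ i j, inner ℝ (w i) (b j) = if i = j then (1 : ℝ) else 0)
    (i j : ι) : inner ℝ (b i) (w j) = if i = j then (1 : ℝ) else 0 := by
  rw [real_inner_comm, h]
  simp only [eq_comm]

theorem linearIndependent_of_biorthogonal
    (h : ∀ i j, inner ℝ (w i) (b j) = if i = j then (1 : ℝ) else 0) : LinearIndependent ℝ w := by
  rw [linearIndependent_iff']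
  intro s g hg i hi
  simpa [sum_inner, real_inner_smul_left, h, hi] using congrArg (inner ℝ · (b i)) hg

variable [Fintype ι]

theorem inner_sum_smul_of_biorthogonal
    (h : ∀ i j, inner ℝ (w i) (b j) = if i = j then (1 : ℝ) else 0) (p : ι → ℝ) (j : ι) :
    inner ℝ (∑ i, p i • w i) (b j) = p j := by
  simp [sum_inner, real_inner_smul_left, h]

theorem inner_sum_zsmul_of_biorthogonal
    (h : ∀ i j, inner ℝ (w i) (b j) = if i = j then (1 : ℝ) else 0) (p : ι → ℤ) (j : ι) :
    inner ℝ (∑ i, p i • w i) (b j) = p j := by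
  simp_rw [← Int.cast_smul_eq_zsmul ℝ]
  exact inner_sum_smul_of_biorthogonal h (fun i => p i) j

end DualBasis

variable {n : ℕ} {L M : Submodule ℤ (Space n)} {U W : Submodule ℝ (Space n)}

section Basis

variable {d : ℕ} {b w : Fin d → Space n}

theorem IsBasis.span_eq (hb : IsBasis L b) : Submodule.span ℝ (Set.range b) = realSpan L := by
  rw [realSpan, ← hb.2, Submodule.span_span_of_tower]

theorem IsBasis.mem (hb : IsBasis L b) (i : Fin d) : b i ∈ L := by
  rw [← hb.2]
  exact Submodule.subset_span ⟨i, rfl⟩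

theorem IsBasis.finrank_eq (hb : IsBasis L b) : finrank ℝ (realSpan L) = d := by
  rw [← hb.span_eq, finrank_span_eq_card hb.1, Fintype.card_fin]

theorem IsBasis.exists_sum_eq (hb : IsBasis L b) {x : Space n} (hx : x ∈ L) :
    ∃ p : Fin d → ℤ, ∑ i, p i • b i = x := by
  rw [← hb.2] at hx
  exact (Submodule.mem_span_range_iff_exists_fun ℤ).1 hx

theorem sum_zsmul_mem_realSpan (hb : ∀ i, b i ∈ realSpan L) (p : Fin d → ℤ) :
    ∑ i, p i • b i ∈ realSpan L :=
  Submodule.sum_mem _ fun i _ => by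
    rw [← Int.cast_smul_eq_zsmul ℝ]
    exact Submodule.smul_mem _ _ (hb i)

theorem IsBasis.dual_of_biorthogonal (hb : IsBasis L b) (hw : ∀ i, w i ∈ realSpan L)
    (h : ∀ i j, inner ℝ (w i) (b j) = if i = j then (1 : ℝ) else 0) : IsBasis (dual L) w := by
  refine ⟨linearIndependent_of_biorthogonal h, le_antisymm (Submodule.span_le.2 ?_) ?_⟩
  · rintro _ ⟨i, rfl⟩
    refine ⟨hw i, fun x hx => ?_⟩
    obtain ⟨p, rfl⟩ := hb.exists_sum_eq hx
    exact ⟨p i, by rw [real_inner_comm, inner_sum_zsmul_of_biorthogonal (biorthogonal_symm h)]⟩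
  · rintro y ⟨hy, hy'⟩
    choose p hp using fun i => hy' (b i) (hb.mem i)
    refine (Submodule.mem_span_range_iff_exists_fun ℤ).2 ⟨p, ?_⟩
    rw [← sub_eq_zero]
    refine eq_zero_of_mem_span_of_inner_eq_zero (s := Set.range b) ?_ ?_
    · exact hb.span_eq ▸ Submodule.sub_mem _ (sum_zsmul_mem_realSpan hw p) hy
    · rintro _ ⟨i, rfl⟩
      rw [inner_sub_left, inner_sum_zsmul_of_biorthogonal h, hp, sub_self]

theorem IsBasis.exists_dual (hb : IsBasis L b) : ∃ w : Fin d → Space n, IsBasis (dual L) w ∧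
    ∀ i j, inner ℝ (w i) (b j) = if i = j then (1 : ℝ) else 0 := by
  obtain ⟨w, hw, h⟩ := exists_biorthogonal hb.1
  exact ⟨w, hb.dual_of_biorthogonal (fun i => hb.span_eq ▸ hw i) h, h⟩

end Basis

theorem isLattice_dual (hL : IsLattice L) : IsLattice (dual L) := by
  obtain ⟨d, b, hb⟩ := hL
  obtain ⟨w, hw, -⟩ := hb.exists_dual
  exact ⟨d, w, hw⟩

theorem realSpan_dual (hL : IsLattice L) : realSpan (dual L) = realSpan L := by
  obtain ⟨d, b, hb⟩ := hL
  obtain ⟨w, hw, -⟩ := hb.exists_dual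
  refine Submodule.eq_of_le_of_finrank_eq ?_ (hw.finrank_eq.trans hb.finrank_eq.symm)
  exact Submodule.span_le.2 fun y hy => hy.1

theorem dual_dual (hL : IsLattice L) : dual (dual L) = L := by
  have hspan := realSpan_dual hL
  obtain ⟨d, b, hb⟩ := hL
  obtain ⟨w, hw, h⟩ := hb.exists_dual
  have hb' : IsBasis (dual (dual L)) b :=
    hw.dual_of_biorthogonal (fun i => hspan ▸ Submodule.subset_span (hb.mem i))
      (biorthogonal_symm h)
  rw [← hb'.2, hb.2]

theorem realSpan_eq_bot_iff : realSpan L = ⊥ ↔ L = ⊥ := by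
  rw [realSpan, Submodule.span_eq_bot, Submodule.eq_bot_iff]
  rfl

theorem dual_ne_bot (hL : IsLattice L) (h0 : L ≠ ⊥) : dual L ≠ ⊥ := by
  rwa [Ne, ← realSpan_eq_bot_iff, realSpan_dual hL, realSpan_eq_bot_iff]

section Discrete

theorem isLattice_of_finrank_le (N : Submodule ℤ (Space n)) [Module.Finite ℤ N]
    (h : finrank ℤ N ≤ finrank ℝ (realSpan N)) : IsLattice N := by
  have : Module.IsTorsionFree ℤ (Space n) := .trans_faithfulSMul ℤ ℝ _
  set c := finBasis ℤ N
  have hspan : Submodule.span ℤ (Set.range fun i => (c i : Space n)) = N := by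
    rw [Set.range_comp' Subtype.val c, ← Submodule.coe_subtype, ← Submodule.map_span, c.span_eq,
      Submodule.map_top, Submodule.range_subtype]
  refine ⟨_, fun i => (c i : Space n), ?_, hspan⟩
  rw [linearIndependent_iff_card_le_finrank_span, Fintype.card_fin]
  rwa [Set.finrank, ← Submodule.span_span_of_tower ℤ ℝ, hspan]

theorem IsLattice.discreteTopology (hL : IsLattice L) : DiscreteTopology L := by
  obtain ⟨d, b, hb⟩ := hL
  have hli := hb.1.linearIndepOn_id
  set B := Basis.extend hli
  have hB : Set.range b ⊆ Set.range B := by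
    rw [Basis.range_extend]
    exact Basis.subset_extend hli
  have hfin : Finite (hli.extend (Set.subset_univ _)) := Module.Finite.finite_basis B
  have hdisc : DiscreteTopology (Submodule.span ℤ (Set.range B)) := inferInstance
  refine DiscreteTopology.of_subset (s := (Submodule.span ℤ (Set.range B) : Set (Space n))) hdisc ?_
  rw [← hb.2]
  exact Submodule.span_mono hB

theorem finrank_realSpan_of_discreteTopology (L : Submodule ℤ (Space n)) [DiscreteTopology L] :
    finrank ℝ (realSpan L) = finrank ℤ L := by
  have h := Real.finrank_eq_int_finrank_of_discrete (s := (L : Set (Space n)))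
    (by rwa [Submodule.span_eq])
  rwa [Set.finrank, Set.finrank, Submodule.span_eq] at h

theorem isLattice_iff_discreteTopology : IsLattice L ↔ DiscreteTopology L :=
  ⟨IsLattice.discreteTopology, fun _ =>
    isLattice_of_finrank_le L (finrank_realSpan_of_discreteTopology L).ge⟩

theorem IsLattice.mono (hM : IsLattice M) (h : L ≤ M) : IsLattice L :=
  isLattice_iff_discreteTopology.2
    (DiscreteTopology.of_subset (s := (M : Set (Space n))) hM.discreteTopology h)

theorem IsLattice.inter_subspace (hM : IsLattice M) (W : Submodule ℝ (Space n)) :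
    IsLattice (inter M W) :=
  hM.mono inf_le_left

end Discrete

section LatticeSubspace

theorem realSpan_inter_le (M : Submodule ℤ (Space n)) (W : Submodule ℝ (Space n)) :
    realSpan (inter M W) ≤ W :=
  Submodule.span_le.2 fun _ hx => hx.2

theorem isLatticeSubspace_iff : IsLatticeSubspace M W ↔ realSpan (inter M W) = W := by
  constructor
  · rintro ⟨b, hb⟩
    refine le_antisymm (realSpan_inter_le M W) fun x hx => ?_
    have hsum : ∑ i, ((b.repr ⟨x, hx⟩ i • b i : W) : Space n) = x := by
      rw [← Submodule.coe_sum, b.sum_repr]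
    rw [← hsum]
    exact Submodule.sum_mem _ fun i _ =>
      Submodule.smul_mem _ _ (Submodule.subset_span ⟨hb i, (b i).2⟩)
  · intro h
    obtain ⟨t, ht, hspan, hli⟩ := exists_linearIndependent ℝ (inter M W : Set (Space n))
    have : Fintype t := @Fintype.ofFinite t hli.finite
    have hW : Submodule.span ℝ (Set.range (Subtype.val : t → Space n)) = W := by
      rw [Subtype.range_coe, hspan, ← realSpan, h]
    set B : Basis t ℝ W := (Basis.span hli).map (LinearEquiv.ofEq _ _ hW)
    refine ⟨B.reindex (Fintype.equivFinOfCardEq (finrank_eq_card_basis B).symm), fun i => ?_⟩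
    simpa [B, Basis.span_apply] using (ht (Subtype.coe_prop _)).1

theorem inter_realSpan (M : Submodule ℤ (Space n)) : inter M (realSpan M) = M :=
  inf_eq_left.2 Submodule.subset_span

theorem isLatticeSubspace_realSpan (M : Submodule ℤ (Space n)) :
    IsLatticeSubspace M (realSpan M) :=
  isLatticeSubspace_iff.2 (congrArg realSpan (inter_realSpan M))

theorem isLatticeSubspace_bot (M : Submodule ℤ (Space n)) : IsLatticeSubspace M ⊥ :=
  isLatticeSubspace_iff.2 (eq_bot_iff.2 (realSpan_inter_le M ⊥))

theorem IsLatticeSubspace.le_realSpan (hW : IsLatticeSubspace M W) : W ≤ realSpan M := by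
  rw [← isLatticeSubspace_iff.1 hW]
  exact Submodule.span_mono fun x hx => hx.1

theorem inter_inter_of_le (M : Submodule ℤ (Space n)) (h : W ≤ U) :
    inter (inter M U) W = inter M W :=
  le_antisymm (fun _ hx => ⟨hx.1.1, hx.2⟩) fun _ hx => ⟨⟨hx.1, h hx.2⟩, hx.2⟩

theorem isLatticeSubspace_inter_iff (h : W ≤ U) :
    IsLatticeSubspace (inter M U) W ↔ IsLatticeSubspace M W := by
  rw [isLatticeSubspace_iff, isLatticeSubspace_iff, inter_inter_of_le M h]

end LatticeSubspace

/-- The orthogonal projection of `L` to `U`. It is a lattice when `U` is the orthogonal complement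
of a lattice subspace of `L`; the paper writes it as the quotient by `L ∩ Uᗮ`. -/
def proj (L : Submodule ℤ (Space n)) (U : Submodule ℝ (Space n)) : Submodule ℤ (Space n) :=
  L.map (U.starProjection.toLinearMap.restrictScalars ℤ)

section Projection

theorem mem_proj {y : Space n} : y ∈ proj L U ↔ ∃ x ∈ L, U.starProjection x = y := Iff.rfl

theorem realSpan_proj (L : Submodule ℤ (Space n)) (U : Submodule ℝ (Space n)) :
    realSpan (proj L U) = (realSpan L).map U.starProjection.toLinearMap := by
  rw [realSpan, realSpan, Submodule.map_span]
  rfl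

theorem realSpan_proj_of_le (hW : W ≤ realSpan L) : realSpan (proj L W) = W := by
  rw [realSpan_proj]
  refine le_antisymm ?_ fun x hx => ⟨x, hW hx, Submodule.starProjection_eq_self_iff.2 hx⟩
  rintro _ ⟨x, -, rfl⟩
  exact Submodule.starProjection_apply_mem W x

theorem realSpan_proj_orthogonal (hW : W ≤ realSpan L) :
    realSpan (proj L Wᗮ) = Wᗮ ⊓ realSpan L := by
  rw [realSpan_proj]
  refine le_antisymm ?_ fun x hx => ⟨x, hx.2, Submodule.starProjection_eq_self_iff.2 hx.1⟩
  rintro _ ⟨x, hx, rfl⟩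
  refine ⟨Submodule.starProjection_apply_mem _ x, ?_⟩
  change Wᗮ.starProjection x ∈ realSpan L
  rw [Submodule.starProjection_orthogonal_val]
  exact Submodule.sub_mem _ hx (hW (Submodule.starProjection_apply_mem W x))

theorem finrank_add_finrank_realSpan_proj_orthogonal (hW : W ≤ realSpan M) :
    finrank ℝ W + finrank ℝ (realSpan (proj M Wᗮ)) = finrank ℝ (realSpan M) := by
  rw [realSpan_proj_orthogonal hW]
  exact Submodule.finrank_add_inf_finrank_orthogonal hW

theorem starProjection_orthogonal_eq_zero_iff {x : Space n} :
    Wᗮ.starProjection x = 0 ↔ x ∈ W := by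
  rw [Submodule.starProjection_apply_eq_zero_iff, Submodule.orthogonal_orthogonal]

theorem proj_orthogonal_bot (M : Submodule ℤ (Space n)) : proj M (⊥ : Submodule ℝ _)ᗮ = M := by
  ext x
  simp [mem_proj, Submodule.starProjection_top]

theorem proj_proj_orthogonal (M : Submodule ℤ (Space n)) {V : Submodule ℝ (Space n)}
    (hV : V ≤ Wᗮ) : proj (proj M Wᗮ) Vᗮ = proj M (W ⊔ V)ᗮ := by
  have hcomp (x : Space n) :
      Vᗮ.starProjection (Wᗮ.starProjection x) = (W ⊔ V)ᗮ.starProjection x := by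
    have hVmem := Submodule.starProjection_apply_mem V (Wᗮ.starProjection x)
    have heq : Vᗮ.starProjection (Wᗮ.starProjection x) =
        Wᗮ.starProjection x - V.starProjection (Wᗮ.starProjection x) :=
      Submodule.starProjection_orthogonal_val _
    refine (Submodule.eq_starProjection_of_mem_orthogonal'
      (z := W.starProjection x + V.starProjection (Wᗮ.starProjection x)) ?_ ?_ ?_).symm
    · rw [← Submodule.inf_orthogonal]
      refine ⟨?_, Submodule.starProjection_apply_mem _ _⟩
      rw [heq]
      exact Submodule.sub_mem _ (Submodule.starProjection_apply_mem _ _) (hV hVmem)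
    · rw [Submodule.orthogonal_orthogonal]
      exact Submodule.add_mem _ (Submodule.mem_sup_left (Submodule.starProjection_apply_mem _ _))
        (Submodule.mem_sup_right hVmem)
    · rw [heq, Submodule.starProjection_orthogonal_val x]
      abel
  ext y
  simp only [mem_proj, exists_exists_and_eq_and, hcomp]

theorem proj_mem_proj {x : Space n} (hx : x ∈ L) : U.starProjection x ∈ proj L U :=
  ⟨x, hx, rfl⟩

theorem IsLattice.proj_orthogonal (hM : IsLattice M) (hW : IsLatticeSubspace M W) :
    IsLattice (proj M Wᗮ) := by
  have := hM.discreteTopology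
  have := (hM.inter_subspace W).discreteTopology
  set f : M →ₗ[ℤ] Space n :=
    (Wᗮ.starProjection.toLinearMap.restrictScalars ℤ).comp M.subtype with hf
  have hrange : LinearMap.range f = proj M Wᗮ := by
    rw [hf, LinearMap.range_comp, Submodule.range_subtype]
    rfl
  have hker : (LinearMap.ker f).map M.subtype = inter M W := by
    ext x
    constructor
    · rintro ⟨y, hy, rfl⟩
      exact ⟨y.2, starProjection_orthogonal_eq_zero_iff.1 hy⟩
    · rintro ⟨hx, hx'⟩
      exact ⟨⟨x, hx⟩, starProjection_orthogonal_eq_zero_iff.2 hx', rfl⟩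
  have hfinrank_ker : finrank ℤ (LinearMap.ker f) = finrank ℝ W := by
    rw [(Submodule.equivSubtypeMap M (LinearMap.ker f)).finrank_eq, hker,
      ← finrank_realSpan_of_discreteTopology, isLatticeSubspace_iff.1 hW]
  have hrank_nullity := Submodule.finrank_quotient_add_finrank (LinearMap.ker f)
  rw [f.quotKerEquivRange.finrank_eq, hfinrank_ker, hrange,
    ← finrank_realSpan_of_discreteTopology M] at hrank_nullity
  have hfinrank := finrank_add_finrank_realSpan_proj_orthogonal hW.le_realSpan
  have : Module.Finite ℤ (proj M Wᗮ) := by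
    rw [← hrange]
    infer_instance
  exact isLattice_of_finrank_le _ (by omega)

theorem inner_starProjection_of_mem {x y : Space n} (hy : y ∈ U) :
    inner ℝ y (U.starProjection x) = inner ℝ y x := by
  rw [← Submodule.inner_starProjection_left_eq_right, Submodule.starProjection_eq_self_iff.2 hy]

theorem dual_proj (hU : realSpan (proj L U) = U ⊓ realSpan L) :
    dual (proj L U) = inter (dual L) U := by
  ext y
  constructor
  · rintro ⟨hy, hy'⟩
    replace hy : y ∈ U ⊓ realSpan L := hU ▸ hy
    refine ⟨⟨hy.2, fun x hx => ?_⟩, hy.1⟩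
    obtain ⟨k, hk⟩ := hy' _ (proj_mem_proj hx)
    exact ⟨k, by rw [← inner_starProjection_of_mem hy.1, hk]⟩
  · rintro ⟨⟨hy, hy'⟩, hyU⟩
    refine ⟨hU.ge ⟨hyU, hy⟩, ?_⟩
    rintro _ ⟨x, hx, rfl⟩
    obtain ⟨k, hk⟩ := hy' x hx
    exact ⟨k, (inner_starProjection_of_mem hyU).trans hk⟩

theorem dual_proj_orthogonal (hW : IsLatticeSubspace M W) :
    dual (proj M Wᗮ) = inter (dual M) Wᗮ :=
  dual_proj (realSpan_proj_orthogonal hW.le_realSpan)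

theorem dual_inter (hM : IsLattice M) (hW : IsLatticeSubspace M W) :
    dual (inter M W) = proj (dual M) W := by
  have hle : W ≤ realSpan (dual M) := realSpan_dual hM ▸ hW.le_realSpan
  have hdual : dual (proj (dual M) W) = inter M W := by
    rw [dual_proj, dual_dual hM]
    rw [realSpan_proj_of_le hle, inf_eq_left.2 hle]
  have hsub : proj (dual M) W ≤ dual (inter M W) := by
    rintro _ ⟨x, hx, rfl⟩
    refine ⟨?_, fun y hy => ?_⟩
    · change W.starProjection x ∈ realSpan (inter M W)
      rw [isLatticeSubspace_iff.1 hW]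
      exact Submodule.starProjection_apply_mem W x
    · obtain ⟨k, hk⟩ := hx.2 y hy.1
      refine ⟨k, ?_⟩
      rw [← hk, real_inner_comm, real_inner_comm y x]
      exact inner_starProjection_of_mem hy.2
  rw [← hdual, dual_dual ((isLattice_dual (hM.inter_subspace W)).mono hsub)]

end Projection

/-- `L` comes within distance `r` of every point of its span, so that `coveringRadius L ≤ r`. -/
def Covers (L : Submodule ℤ (Space n)) (r : ℝ) : Prop :=
  ∀ x ∈ realSpan L, ∃ v ∈ L, ‖x - v‖ ≤ r

section Covering

theorem coveringRadius_le {r : ℝ} (hr : 0 ≤ r) (h : Covers L r) : coveringRadius L ≤ r :=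
  csInf_le ⟨0, fun _ h => h.1⟩ ⟨hr, h⟩

theorem Covers.mono {r s : ℝ} (h : Covers L r) (hrs : r ≤ s) : Covers L s := fun x hx =>
  let ⟨v, hv, hvx⟩ := h x hx
  ⟨v, hv, hvx.trans hrs⟩

/- Round the component in `W` by a vector of `M*` projected to `W`, then correct the component in
`Wᗮ` by a vector of `M* ∩ Wᗮ`, which leaves the first component alone. -/
theorem covers_dual_of_inter_of_proj (hM : IsLattice M) (hW : IsLatticeSubspace M W) {r₁ r₂ : ℝ}
    (h₁ : Covers (dual (inter M W)) r₁) (h₂ : Covers (dual (proj M Wᗮ)) r₂) :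
    Covers (dual M) √(r₁ ^ 2 + r₂ ^ 2) := by
  intro x hx
  have hle : W ≤ realSpan (dual M) := realSpan_dual hM ▸ hW.le_realSpan
  rw [dual_inter hM hW] at h₁
  obtain ⟨_, ⟨v, hvM, rfl⟩, hv⟩ := h₁ (W.starProjection x)
    ((realSpan_proj_of_le hle).ge (Submodule.starProjection_apply_mem W x))
  obtain ⟨u, hu, hux⟩ := h₂ (Wᗮ.starProjection (x - v)) (by
    rw [realSpan_dual (hM.proj_orthogonal hW), realSpan_proj, ← realSpan_dual hM]
    exact ⟨x - v, Submodule.sub_mem _ hx (Submodule.subset_span hvM), rfl⟩)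
  rw [dual_proj_orthogonal hW] at hu
  refine ⟨v + u, Submodule.add_mem _ hvM hu.1, Real.le_sqrt_of_sq_le ?_⟩
  have hcomp : W.starProjection (x - (v + u)) = W.starProjection x - W.starProjection v := by
    rw [map_sub, map_add, (Submodule.starProjection_apply_eq_zero_iff W).2 hu.2, add_zero]
  have hcomp' : Wᗮ.starProjection (x - (v + u)) = Wᗮ.starProjection (x - v) - u := by
    rw [← sub_sub, map_sub, Submodule.starProjection_eq_self_iff.2 hu.2]
  rw [Submodule.norm_sq_eq_add_norm_sq_starProjection _ W, hcomp, hcomp']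
  gcongr
  exact hv

end Covering

section Determinant

theorem gramVolume_eq_sqrt_det_gram {d : ℕ} (b : Fin d → Space n) :
    gramVolume b = √(Matrix.gram ℝ b).det := rfl

theorem gramVolume_pos {d : ℕ} {b : Fin d → Space n} (hb : LinearIndependent ℝ b) :
    0 < gramVolume b :=
  Real.sqrt_pos.2 (Matrix.posDef_gram_of_linearIndependent (𝕜 := ℝ) hb).det_pos

theorem det_pos (hL : IsLattice L) : 0 < det L := by
  obtain ⟨d, b, hb⟩ := hL
  rw [det_eq_gramVolume hb]
  exact gramVolume_pos hb.1

theorem det_bot : det (⊥ : Submodule ℤ (Space n)) = 1 := by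
  have hb : IsBasis ⊥ (Fin.elim0 : Fin 0 → Space n) := ⟨linearIndependent_empty_type, by simp⟩
  rw [det_eq_gramVolume hb, gramVolume, Matrix.det_fin_zero, Real.sqrt_one]

theorem gram_sum_smul {d e : ℕ} (T : Matrix (Fin e) (Fin d) ℝ) (b : Fin d → Space n) :
    Matrix.gram ℝ (fun i => ∑ j, T i j • b j) = T * Matrix.gram ℝ b * T.transpose := by
  ext i k
  simp only [Matrix.gram_apply, Matrix.mul_apply, Matrix.transpose_apply, inner_sum, sum_inner,
    real_inner_smul_left, real_inner_smul_right, Finset.sum_mul]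
  exact Finset.sum_congr rfl fun _ _ => Finset.sum_congr rfl fun _ _ => by ring

theorem gramVolume_sum_smul {d : ℕ} (T : Matrix (Fin d) (Fin d) ℝ) (b : Fin d → Space n) :
    gramVolume (fun i => ∑ j, T i j • b j) = |T.det| * gramVolume b := by
  rw [gramVolume_eq_sqrt_det_gram, gramVolume_eq_sqrt_det_gram, gram_sum_smul, Matrix.det_mul,
    Matrix.det_mul, Matrix.det_transpose, mul_right_comm, Real.sqrt_mul (mul_self_nonneg _),
    Real.sqrt_mul_self_eq_abs]

theorem gramVolume_append_of_inner_eq_zero {d e : ℕ} (c : Fin d → Space n) (u : Fin e → Space n)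
    (hcu : ∀ i j, inner ℝ (c i) (u j) = (0 : ℝ)) :
    gramVolume (Fin.append c u) = gramVolume c * gramVolume u := by
  have hgram : (Matrix.gram ℝ (Fin.append c u)).submatrix finSumFinEquiv finSumFinEquiv =
      Matrix.fromBlocks (Matrix.gram ℝ c) 0 0 (Matrix.gram ℝ u) := by
    ext (i | i) (j | j)
    · simp [Matrix.gram_apply]
    · simp [Matrix.gram_apply, hcu]
    · simp [Matrix.gram_apply, real_inner_comm, hcu]
    · simp [Matrix.gram_apply]
  rw [gramVolume_eq_sqrt_det_gram, gramVolume_eq_sqrt_det_gram, gramVolume_eq_sqrt_det_gram,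
    ← Real.sqrt_mul (Matrix.posSemidef_gram ℝ c).det_nonneg,
    ← Matrix.det_submatrix_equiv_self finSumFinEquiv, hgram, Matrix.det_fromBlocks_zero₁₂]

theorem gramVolume_append {d e : ℕ} (c : Fin d → Space n) (u v : Fin e → Space n)
    (hcu : ∀ i j, inner ℝ (c i) (u j) = (0 : ℝ))
    (hv : ∀ j, v j - u j ∈ Submodule.span ℝ (Set.range c)) :
    gramVolume (Fin.append c v) = gramVolume c * gramVolume u := by
  choose A hA using fun j => (Submodule.mem_span_range_iff_exists_fun ℝ).1 (hv j)
  set T : Matrix (Fin d ⊕ Fin e) (Fin d ⊕ Fin e) ℝ := Matrix.fromBlocks 1 0 (Matrix.of A) 1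
  set T' := T.submatrix finSumFinEquiv.symm finSumFinEquiv.symm
  have hdet : T'.det = 1 := by
    rw [Matrix.det_submatrix_equiv_self, Matrix.det_fromBlocks_zero₁₂, Matrix.det_one,
      Matrix.det_one, one_mul]
  have hT : Fin.append c v = fun i => ∑ j, T' i j • Fin.append c u j := by
    funext i
    obtain ⟨i | i, rfl⟩ := finSumFinEquiv.surjective i
    · simp [T', T, Fin.sum_univ_add, Matrix.one_apply]
    · simp [T', T, Fin.sum_univ_add, Matrix.one_apply, hA]
  rw [hT, gramVolume_sum_smul, hdet, abs_one, one_mul, gramVolume_append_of_inner_eq_zero c u hcu]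

theorem linearIndependent_append_of_map {R E F : Type*} [Ring R] [AddCommGroup E] [Module R E]
    [AddCommGroup F] [Module R F] {d e : ℕ} {c : Fin d → E} {v : Fin e → E}
    (hc : LinearIndependent R c) {f : E →ₗ[R] F} (hfc : ∀ i, f (c i) = 0)
    (hv : LinearIndependent R (f ∘ v)) : LinearIndependent R (Fin.append c v) := by
  rw [Fintype.linearIndependent_iff] at hc hv ⊢
  intro g hg
  rw [Fin.sum_univ_add] at hg
  simp only [Fin.append_left, Fin.append_right] at hg
  have hgv : ∀ j, g (Fin.natAdd d j) = 0 := hv _ (by simpa [hfc] using congrArg f hg)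
  have hgc : ∀ i, g (Fin.castAdd e i) = 0 := hc _ (by simpa [hgv] using hg)
  exact fun i => Fin.addCases hgc hgv i

theorem IsBasis.append {d e : ℕ} {c : Fin d → Space n} {u v : Fin e → Space n}
    (hc : IsBasis (inter M W) c) (hu : IsBasis (proj M Wᗮ) u) (hvM : ∀ j, v j ∈ M)
    (hv : ∀ j, Wᗮ.starProjection (v j) = u j) : IsBasis M (Fin.append c v) := by
  constructor
  · refine linearIndependent_append_of_map hc.1 (f := Wᗮ.starProjection.toLinearMap)
      (fun i => starProjection_orthogonal_eq_zero_iff.2 (hc.mem i).2) ?_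
    rw [show ⇑Wᗮ.starProjection.toLinearMap ∘ v = u from funext hv]
    exact hu.1
  refine le_antisymm (Submodule.span_le.2 ?_) fun m hm => ?_
  · rintro _ ⟨i, rfl⟩
    refine Fin.addCases (fun i => ?_) (fun i => ?_) i
    · simpa using (hc.mem i).1
    · simpa using hvM i
  · obtain ⟨p, hp⟩ := hu.exists_sum_eq (proj_mem_proj (U := Wᗮ) hm)
    have hdiff : m - ∑ j, p j • v j ∈ inter M W := by
      refine ⟨Submodule.sub_mem _ hm (Submodule.sum_mem _ fun j _ =>
        Submodule.smul_mem _ _ (hvM j)), starProjection_orthogonal_eq_zero_iff.1 ?_⟩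
      simp only [map_sub, map_sum, map_zsmul, hv, hp, sub_self]
    obtain ⟨q, hq⟩ := hc.exists_sum_eq hdiff
    refine (Submodule.mem_span_range_iff_exists_fun ℤ).2 ⟨Fin.append q p, ?_⟩
    simp only [Fin.sum_univ_add, Fin.append_left, Fin.append_right, hq, sub_add_cancel]

theorem det_eq_det_inter_mul_det_proj (hM : IsLattice M) (hW : IsLatticeSubspace M W) :
    det M = det (inter M W) * det (proj M Wᗮ) := by
  obtain ⟨d, c, hc⟩ := hM.inter_subspace W
  obtain ⟨e, u, hu⟩ := hM.proj_orthogonal hW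
  choose v hvM hv using fun j => mem_proj.1 (hu.mem j)
  rw [det_eq_gramVolume (hc.append hu hvM hv), det_eq_gramVolume hc, det_eq_gramVolume hu]
  refine gramVolume_append c u v (fun i j => ?_) fun j => ?_
  · rw [← hv]
    exact Submodule.starProjection_apply_mem Wᗮ _ _ (hc.mem i).2
  · rw [hc.span_eq, isLatticeSubspace_iff.1 hW, ← hv, Submodule.starProjection_orthogonal_val,
      sub_sub_cancel]
    exact Submodule.starProjection_apply_mem W _

end Determinant

section Lifting

variable {V : Submodule ℝ (Space n)}

theorem IsLatticeSubspace.le_orthogonal (hW : W ≤ realSpan M)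
    (hV : IsLatticeSubspace (proj M Wᗮ) V) : V ≤ Wᗮ :=
  hV.le_realSpan.trans ((realSpan_proj_orthogonal hW).le.trans inf_le_left)

theorem proj_inter_sup (M : Submodule ℤ (Space n)) (hV : V ≤ Wᗮ) :
    proj (inter M (W ⊔ V)) Wᗮ = inter (proj M Wᗮ) V := by
  ext y
  constructor
  · rintro ⟨x, ⟨hx, hx'⟩, rfl⟩
    refine ⟨proj_mem_proj hx, ?_⟩
    obtain ⟨w, hw, v, hv, rfl⟩ := Submodule.mem_sup.1 hx'
    change Wᗮ.starProjection (w + v) ∈ V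
    rwa [map_add, starProjection_orthogonal_eq_zero_iff.2 hw,
      Submodule.starProjection_eq_self_iff.2 (hV hv), zero_add]
  · rintro ⟨⟨x, hx, rfl⟩, hxV⟩
    refine proj_mem_proj ⟨hx, Submodule.mem_sup.2 ⟨W.starProjection x,
      Submodule.starProjection_apply_mem _ _, Wᗮ.starProjection x, hxV, ?_⟩⟩
    exact Submodule.starProjection_add_starProjection_orthogonal (K := W) x

theorem IsLatticeSubspace.sup (hW : IsLatticeSubspace M W)
    (hV : IsLatticeSubspace (proj M Wᗮ) V) : IsLatticeSubspace M (W ⊔ V) := by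
  have hWle := ((isLatticeSubspace_inter_iff (le_sup_left (b := V))).2 hW).le_realSpan
  have hspan := realSpan_proj_orthogonal hWle
  rw [proj_inter_sup M (hV.le_orthogonal hW.le_realSpan), isLatticeSubspace_iff.1 hV] at hspan
  exact isLatticeSubspace_iff.2
    (le_antisymm (realSpan_inter_le _ _) (sup_le hWle (hspan.le.trans inf_le_right)))

theorem finrank_sup_of_le_orthogonal (hV : V ≤ Wᗮ) :
    finrank ℝ (W ⊔ V : Submodule ℝ (Space n)) = finrank ℝ W + finrank ℝ V := by
  have hdisj : W ⊓ V = ⊥ :=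
    eq_bot_iff.2 ((inf_le_inf_left _ hV).trans (Submodule.inf_orthogonal_eq_bot W).le)
  rw [← Submodule.finrank_sup_add_finrank_inf_eq, hdisj, finrank_bot, add_zero]

theorem det_inter_sup (hM : IsLattice M) (hW : IsLatticeSubspace M W) (hV : V ≤ Wᗮ) :
    det (inter M (W ⊔ V)) = det (inter M W) * det (inter (proj M Wᗮ) V) := by
  rw [det_eq_det_inter_mul_det_proj (hM.inter_subspace (W ⊔ V))
    ((isLatticeSubspace_inter_iff le_sup_left).2 hW), inter_inter_of_le M le_sup_left,
    proj_inter_sup M hV]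

theorem IsLatticeSubspace.exists_sup_eq (hW : IsLatticeSubspace M W) (hU : IsLatticeSubspace M U)
    (hWU : W ≤ U) : ∃ V, IsLatticeSubspace (proj M Wᗮ) V ∧ W ⊔ V = U := by
  have hspan : realSpan (proj (inter M U) Wᗮ) = Wᗮ ⊓ U := by
    rw [realSpan_proj_orthogonal, isLatticeSubspace_iff.1 hU]
    exact ((isLatticeSubspace_inter_iff hWU).2 hW).le_realSpan
  refine ⟨Wᗮ ⊓ U, isLatticeSubspace_iff.2 (le_antisymm (realSpan_inter_le _ _) ?_),
    Submodule.sup_orthogonal_inf_of_hasOrthogonalProjection hWU⟩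
  rw [← hspan]
  refine Submodule.span_mono fun y hy => ⟨?_, Submodule.subset_span hy⟩
  exact Submodule.map_mono inf_le_left hy

end Lifting

section SmoothingParameter

theorem smoothingParameterEps_spec (hL : IsLattice L) (h0 : L ≠ ⊥) {ε : ℝ} (hε : 0 < ε) :
    0 < smoothingParameterEps ε L ∧ HasSum (fun y : dual L =>
      Real.exp (-Real.pi * ‖smoothingParameterEps ε L • (y : Space n)‖ ^ 2)) (1 + ε) := by
  have := (isLattice_dual hL).discreteTopology
  obtain ⟨s, hs, hs_unique⟩ :=
    existsUnique_hasSum_exp_neg_pi_mul_norm_smul_sq (dual L) (dual_ne_bot hL h0) hε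
  have heq : smoothingParameterEps ε L = s := by
    have hset : {t : ℝ | 0 < t ∧ HasSum (fun y : dual L =>
        Real.exp (-Real.pi * ‖t • (y : Space n)‖ ^ 2)) (1 + ε)} = {s} :=
      Set.eq_singleton_iff_unique_mem.2 ⟨hs, hs_unique⟩
    rw [smoothingParameterEps, hset, csInf_singleton]
  rwa [heq]

theorem smoothingParameter_spec (hL : IsLattice L) (h0 : L ≠ ⊥) :
    0 < smoothingParameter L ∧ HasSum (fun y : dual L =>
      Real.exp (-Real.pi * ‖smoothingParameter L • (y : Space n)‖ ^ 2)) (3 / 2) := by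
  have h := smoothingParameterEps_spec hL h0 one_half_pos
  rwa [show (1 + 1 / 2 : ℝ) = 3 / 2 by norm_num] at h

variable {d : ℕ} {b w : Fin d → Space n}

theorem IsBasis.bijective_sum_zsmul (hw : IsBasis L w) :
    Function.Bijective fun k : Fin d → ℤ =>
      (⟨∑ i, k i • w i, Submodule.sum_mem _ fun i _ => Submodule.smul_mem _ _ (hw.mem i)⟩ : L) := by
  constructor
  · have hli : LinearIndependent ℤ w := hw.1.restrict_scalars' ℤ
    exact fun k l hkl => hli.fintypeLinearCombination_injective (congrArg Subtype.val hkl)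
  · rintro ⟨y, hy⟩
    obtain ⟨k, rfl⟩ := hw.exists_sum_eq hy
    exact ⟨k, rfl⟩

theorem covers_of_hasSum_dual (hL : IsLattice L) {s S : ℝ} (hs : 0 < s) (hS : S ≤ 3 / 2)
    (hsum : HasSum (fun y : dual L => Real.exp (-Real.pi * ‖s • (y : Space n)‖ ^ 2)) S) :
    Covers L (√(finrank ℝ (realSpan L)) * s) := by
  obtain ⟨d, b, hb⟩ := hL
  obtain ⟨w, hw, h⟩ := hb.exists_dual
  set B : Basis (Fin d) ℝ (realSpan L) :=
    (Basis.span hb.1).map (LinearEquiv.ofEq _ _ hb.span_eq) with hBdef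
  have hB : ∀ i, (B i : Space n) = b i := fun i => by simp [hBdef, Basis.span_apply]
  set w' : Fin d → realSpan L := fun i => ⟨w i, (hw.mem i).1⟩
  have hw' : ∀ i (x : realSpan L), inner ℝ (w' i) x = B.repr x i := by
    intro i x
    have hx : (x : Space n) = ∑ j, B.repr x j • b j := by
      conv_lhs => rw [← B.sum_repr x]
      simp only [Submodule.coe_sum, Submodule.coe_smul, hB]
    rw [Submodule.coe_inner, real_inner_comm, hx,
      inner_sum_smul_of_biorthogonal (biorthogonal_symm h)]
  have hsum' : HasSum (fun k : Fin d → ℤ =>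
      Real.exp (-Real.pi * ‖s • ∑ i, k i • w' i‖ ^ 2)) S := by
    rw [← (Equiv.ofBijective _ hw.bijective_sum_zsmul).hasSum_iff] at hsum
    convert hsum using 4 with k
    simp [w']
  intro x hx
  obtain ⟨v, hv, hvx⟩ := exists_mem_norm_add_le B hw' hs hS hsum' (-⟨x, hx⟩)
  refine ⟨v, ?_, by rwa [norm_sub_rev, sub_eq_add_neg]⟩
  obtain ⟨p, rfl⟩ := (Submodule.mem_span_range_iff_exists_fun ℤ).1 hv
  simp only [Submodule.coe_sum, Submodule.coe_smul_of_tower, hB]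
  exact Submodule.sum_mem _ fun i _ => Submodule.smul_mem _ _ (hb.mem i)

theorem covers_smoothingParameter (hL : IsLattice L) (h0 : L ≠ ⊥) :
    Covers L (√(finrank ℝ (realSpan L)) * smoothingParameter L) := by
  obtain ⟨hη, hsum⟩ := smoothingParameter_spec hL h0
  exact covers_of_hasSum_dual hL hη le_rfl hsum

end SmoothingParameter

section ScaledDeterminant

theorem pow_mul_le_one_iff_le_rpow {t a : ℝ} (ht : 0 < t) (ha : 0 < a) {d : ℕ} (hd : d ≠ 0) :
    t ^ d * a ≤ 1 ↔ t ≤ a ^ (-(1 / (d : ℝ))) := by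
  rw [← le_div_iff₀ ha, one_div, one_div, Real.rpow_neg ha.le, ← Real.inv_rpow ha.le,
    Real.le_rpow_inv_iff_of_pos ht.le (inv_pos.2 ha).le (by positivity), Real.rpow_natCast]

theorem one_le_pow_mul_iff_rpow_le {t a : ℝ} (ht : 0 < t) (ha : 0 < a) {d : ℕ} (hd : d ≠ 0) :
    1 ≤ t ^ d * a ↔ a ^ (-(1 / (d : ℝ))) ≤ t := by
  rw [← div_le_iff₀ ha, one_div, one_div, Real.rpow_neg ha.le, ← Real.inv_rpow ha.le,
    Real.rpow_inv_le_iff_of_pos (inv_pos.2 ha).le ht.le (by positivity), Real.rpow_natCast]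

variable {V : Submodule ℝ (Space n)} {t : ℝ}

/-- The determinant of the lattice `t • (M ∩ W)`, for `t > 0`. It is at most `1` exactly when
`t ≤ det (M ∩ W) ^ (-1 / dim W)`, and unlike the latter it is multiplicative along `W`. -/
def scaledDet (M : Submodule ℤ (Space n)) (t : ℝ) (W : Submodule ℝ (Space n)) : ℝ :=
  t ^ finrank ℝ W * det (inter M W)

/-- Every sublattice `t • (M ∩ W)` of `t • M` has determinant at least `1`; equivalently,
`det (M ∩ W) ^ (-1 / dim W) ≤ t` for all lattice subspaces `W ≠ 0` of `M`. -/
def DetLowerBound (M : Submodule ℤ (Space n)) (t : ℝ) : Prop :=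
  ∀ W, IsLatticeSubspace M W → 1 ≤ scaledDet M t W

theorem scaledDet_bot : scaledDet M t ⊥ = 1 := by
  have hbot : inter M ⊥ = ⊥ := by
    simp [inter]
  rw [scaledDet, hbot, det_bot, finrank_bot, pow_zero, one_mul]

theorem scaledDet_mono (hM : IsLattice M) {s : ℝ} (hs : 0 ≤ s) (hst : s ≤ t) :
    scaledDet M s W ≤ scaledDet M t W :=
  mul_le_mul_of_nonneg_right (pow_le_pow_left₀ hs hst _) (det_pos (hM.inter_subspace W)).le

theorem scaledDet_le_one_iff (hM : IsLattice M) (ht : 0 < t) (hW : W ≠ ⊥) :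
    scaledDet M t W ≤ 1 ↔ t ≤ det (inter M W) ^ (-(1 / (finrank ℝ W : ℝ))) :=
  pow_mul_le_one_iff_le_rpow ht (det_pos (hM.inter_subspace W))
    (Submodule.finrank_eq_zero.not.2 hW)

theorem one_le_scaledDet_iff (hM : IsLattice M) (ht : 0 < t) (hW : W ≠ ⊥) :
    1 ≤ scaledDet M t W ↔ det (inter M W) ^ (-(1 / (finrank ℝ W : ℝ))) ≤ t :=
  one_le_pow_mul_iff_rpow_le ht (det_pos (hM.inter_subspace W))
    (Submodule.finrank_eq_zero.not.2 hW)

theorem scaledDet_sup (hM : IsLattice M) (hW : IsLatticeSubspace M W) (hV : V ≤ Wᗮ) :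
    scaledDet M t (W ⊔ V) = scaledDet M t W * scaledDet (proj M Wᗮ) t V := by
  rw [scaledDet, scaledDet, scaledDet, det_inter_sup hM hW hV, finrank_sup_of_le_orthogonal hV,
    pow_add, mul_mul_mul_comm]

theorem DetLowerBound.inter (h : DetLowerBound M t) (U : Submodule ℝ (Space n)) :
    DetLowerBound (inter M U) t := by
  intro W hW
  have hWU : W ≤ U := hW.le_realSpan.trans (realSpan_inter_le M U)
  rw [scaledDet, inter_inter_of_le M hWU]
  exact h W ((isLatticeSubspace_inter_iff hWU).1 hW)

theorem exists_ge_detLowerBound_proj (hM : IsLattice M) (hW : IsLatticeSubspace M W)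
    (hWt : scaledDet M t W ≤ 1) (ht : 0 ≤ t) :
    ∃ U, W ≤ U ∧ IsLatticeSubspace M U ∧ scaledDet M t U ≤ 1 ∧ DetLowerBound (proj M Uᗮ) t := by
  obtain ⟨U, hWU, ⟨hU, hUt⟩, hmax⟩ := exists_maximal_ge_of_wellFoundedGT
    (fun U => IsLatticeSubspace M U ∧ scaledDet M t U ≤ 1) W ⟨hW, hWt⟩
  refine ⟨U, hWU, hU, hUt, fun V hV => ?_⟩
  by_contra! hVt
  have hVU := hV.le_orthogonal hU.le_realSpan
  have hdet_nonneg : 0 ≤ scaledDet (proj M Uᗮ) t V :=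
    mul_nonneg (pow_nonneg ht _) (det_pos ((hM.proj_orthogonal hU).inter_subspace V)).le
  have hsup : scaledDet M t (U ⊔ V) ≤ 1 := by
    rw [scaledDet_sup hM hU hVU]
    exact mul_le_one₀ hUt hdet_nonneg hVt.le
  have hV_le : V ≤ U := le_sup_right.trans (hmax ⟨hU.sup hV, hsup⟩ le_sup_left)
  have hV_bot : V = ⊥ :=
    eq_bot_iff.2 ((le_inf hV_le hVU).trans (Submodule.inf_orthogonal_eq_bot U).le)
  rw [hV_bot, scaledDet_bot] at hVt
  exact lt_irrefl _ hVt

end ScaledDeterminant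

section HarmonicSum

theorem harmonic_mono : Monotone harmonic :=
  monotone_nat_of_le_succ fun k => by
    rw [harmonic_succ]
    exact le_add_of_nonneg_right (by positivity)

theorem sub_le_mul_harmonic_sub {d e : ℕ} (h : d ≤ e) :
    (e - d : ℚ) ≤ e * (harmonic e - harmonic d) := by
  induction e, h using Nat.le_induction with
  | base => simp
  | succ e hde ih =>
    have hmono := harmonic_mono hde
    have hinv : ((e + 1 : ℕ) : ℚ) * ((e + 1 : ℕ) : ℚ)⁻¹ = 1 := mul_inv_cancel₀ (by positivity)
    rw [harmonic_succ, add_sub_right_comm, mul_add, hinv]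
    push_cast
    linarith

end HarmonicSum

section KannanLovasz

variable {t C K : ℝ}

theorem covers_dual_bot {r : ℝ} (hr : 0 ≤ r) : Covers (dual (⊥ : Submodule ℤ (Space n))) r := by
  have hspan : realSpan (dual (⊥ : Submodule ℤ (Space n))) ≤ ⊥ :=
    Submodule.span_le.2 fun y hy => (realSpan_eq_bot_iff.2 rfl).le hy.1
  intro x hx
  exact ⟨0, zero_mem _, by rwa [(Submodule.mem_bot ℝ).1 (hspan hx), sub_zero, norm_zero]⟩

/-- If all the determinants of sublattices of `t • N` are at least `1`, then the covering radius of
`N*` is at most `√(rank N) * (C * t)`. -/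
def IsCoveringConstant (n : ℕ) (C : ℝ) : Prop :=
  ∀ N : Submodule ℤ (Space n), IsLattice N → ∀ t : ℝ, 0 < t → DetLowerBound N t →
    Covers (dual N) (√(finrank ℝ (realSpan N)) * (C * t))

/-- `K` bounds the quantities `√d * det (M ∩ W) ^ (-1 / d)`, `d = dim W ≥ 1`, whose maximum is the
right-hand side of the Kannan–Lovász inequality for the dual of `M`. -/
def IsKLBound (M : Submodule ℤ (Space n)) (K : ℝ) : Prop :=
  ∀ W, IsLatticeSubspace M W → 1 ≤ finrank ℝ W →
    √(finrank ℝ W) * det (inter M W) ^ (-(1 / (finrank ℝ W : ℝ))) ≤ K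

theorem IsKLBound.detLowerBound (hM : IsLattice M) (hK : 0 < K) (h : IsKLBound M K) :
    DetLowerBound M K := by
  intro W hW
  rcases eq_or_ne W ⊥ with rfl | hW0
  · exact scaledDet_bot.ge
  have hd : 1 ≤ finrank ℝ W := Submodule.one_le_finrank_iff.2 hW0
  refine (one_le_scaledDet_iff hM hK hW0).2 (le_trans ?_ (h W hW hd))
  refine le_mul_of_one_le_left (Real.rpow_nonneg (det_pos (hM.inter_subspace W)).le _) ?_
  exact Real.one_le_sqrt.2 (by exact_mod_cast hd)

theorem IsKLBound.finrank_mul_sq_le (hM : IsLattice M) (h : IsKLBound M K)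
    (hW : IsLatticeSubspace M W) (ht : 0 < t) (hWt : scaledDet M t W ≤ 1) :
    finrank ℝ W * t ^ 2 ≤ K ^ 2 := by
  rcases eq_or_ne W ⊥ with rfl | hW0
  · simpa using sq_nonneg K
  have hle : √(finrank ℝ W) * t ≤ K :=
    (mul_le_mul_of_nonneg_left ((scaledDet_le_one_iff hM ht hW0).1 hWt) (Real.sqrt_nonneg _)).trans
      (h W hW (Submodule.one_le_finrank_iff.2 hW0))
  calc finrank ℝ W * t ^ 2 = (√(finrank ℝ W) * t) ^ 2 := by
        rw [mul_pow, Real.sq_sqrt (Nat.cast_nonneg _)]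
    _ ≤ K ^ 2 := by gcongr

theorem IsCoveringConstant.covers_dual_proj (hC : IsCoveringConstant n C) (hM : IsLattice M)
    (hW : IsLatticeSubspace M W) (hU : IsLatticeSubspace M U) (hWU : W ≤ U)
    (ht : 0 < t) (hWt : DetLowerBound (proj M Wᗮ) t) {r : ℝ} (h : Covers (dual (proj M Uᗮ)) r) :
    Covers (dual (proj M Wᗮ)) √((finrank ℝ U - finrank ℝ W) * (C * t) ^ 2 + r ^ 2) := by
  obtain ⟨V, hV, rfl⟩ := hW.exists_sup_eq hU hWU
  have hVW := hV.le_orthogonal hW.le_realSpan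
  have hN := hM.proj_orthogonal hW
  have hcover := hC _ (hN.inter_subspace V) t ht (hWt.inter V)
  rw [isLatticeSubspace_iff.1 hV] at hcover
  rw [← proj_proj_orthogonal M hVW] at h
  convert covers_dual_of_inter_of_proj hN hV hcover h using 3
  rw [finrank_sup_of_le_orthogonal hVW, mul_pow √_, Real.sq_sqrt (Nat.cast_nonneg _)]
  push_cast
  ring

/- The increment `dim U - dim W` is charged to the harmonic numbers: since
`dim U * (t / 2) ^ 2 ≤ K ^ 2`, its contribution is at most
`(2 * C * K) ^ 2 * (H (dim U) - H (dim W))`, and these telescope. -/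
theorem IsCoveringConstant.covers_dual_proj_harmonic (hC : IsCoveringConstant n C) (hC0 : 0 ≤ C)
    (hM : IsLattice M) (hK : 0 ≤ K) (hMK : IsKLBound M K)
    (hW : IsLatticeSubspace M W) (hU : IsLatticeSubspace M U) (hWU : W ≤ U) (ht : 0 < t)
    (hWt : DetLowerBound (proj M Wᗮ) t) (hUt : scaledDet M (t / 2) U ≤ 1)
    {h : ℚ} (hh : harmonic (finrank ℝ U) ≤ h)
    (hcover : Covers (dual (proj M Uᗮ)) (2 * C * K * √(h - harmonic (finrank ℝ U)))) :
    Covers (dual (proj M Wᗮ)) (2 * C * K * √(h - harmonic (finrank ℝ W))) := by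
  have hdim := Submodule.finrank_mono (R := ℝ) hWU
  have hmono : (harmonic (finrank ℝ W) : ℝ) ≤ harmonic (finrank ℝ U) := by
    exact_mod_cast harmonic_mono hdim
  have hh' : (harmonic (finrank ℝ U) : ℝ) ≤ h := by exact_mod_cast hh
  have hharm : (finrank ℝ U - finrank ℝ W : ℝ) ≤
      finrank ℝ U * (harmonic (finrank ℝ U) - harmonic (finrank ℝ W)) := by
    exact_mod_cast sub_le_mul_harmonic_sub hdim
  have hKt := hMK.finrank_mul_sq_le hM hU (half_pos ht) hUt
  have hincr : (finrank ℝ U - finrank ℝ W) * t ^ 2 ≤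
      4 * K ^ 2 * (harmonic (finrank ℝ U) - harmonic (finrank ℝ W)) :=
    calc (finrank ℝ U - finrank ℝ W) * t ^ 2
        ≤ finrank ℝ U * (harmonic (finrank ℝ U) - harmonic (finrank ℝ W)) * t ^ 2 := by gcongr
      _ = 4 * (finrank ℝ U * (t / 2) ^ 2) *
          (harmonic (finrank ℝ U) - harmonic (finrank ℝ W)) := by ring
      _ ≤ _ := by gcongr
  refine (hC.covers_dual_proj hM hW hU hWU ht hWt hcover).mono
    (Real.sqrt_le_iff.2 ⟨by positivity, ?_⟩)
  rw [mul_pow _ √_, mul_pow _ √_, Real.sq_sqrt (sub_nonneg.2 hh'),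
    Real.sq_sqrt (sub_nonneg.2 (hmono.trans hh'))]
  linear_combination C ^ 2 * hincr

theorem covers_dual_proj_realSpan {r : ℝ} (hr : 0 ≤ r) :
    Covers (dual (proj M (realSpan M)ᗮ)) r := by
  have hbot : proj M (realSpan M)ᗮ = ⊥ := by
    rw [← realSpan_eq_bot_iff, realSpan_proj_orthogonal le_rfl, inf_comm,
      Submodule.inf_orthogonal_eq_bot]
  rw [hbot]
  exact covers_dual_bot hr

theorem IsCoveringConstant.covers_dual_proj_of_scaledDet_le_one (hC : IsCoveringConstant n C)
    (hC0 : 0 ≤ C) (hM : IsLattice M) (hK : 0 ≤ K) (hMK : IsKLBound M K) (j : ℕ)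
    (hj : scaledDet M (t / 2 ^ j) (realSpan M) ≤ 1) (hW : IsLatticeSubspace M W) (ht : 0 < t)
    (hWt : DetLowerBound (proj M Wᗮ) t) (hWt' : scaledDet M t W ≤ 1) :
    Covers (dual (proj M Wᗮ))
      (2 * C * K * √(harmonic (finrank ℝ (realSpan M)) - harmonic (finrank ℝ W))) := by
  induction j generalizing t W with
  | zero =>
    refine hC.covers_dual_proj_harmonic hC0 hM hK hMK hW (isLatticeSubspace_realSpan M)
      hW.le_realSpan ht hWt ?_ le_rfl (covers_dual_proj_realSpan (by positivity))
    rw [pow_zero, div_one] at hj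
    exact (scaledDet_mono hM (half_pos ht).le (half_le_self ht.le)).trans hj
  | succ j ih =>
    obtain ⟨U, hWU, hU, hUt, hUt'⟩ := exists_ge_detLowerBound_proj hM hW
      ((scaledDet_mono hM (half_pos ht).le (half_le_self ht.le)).trans hWt') (half_pos ht).le
    refine hC.covers_dual_proj_harmonic hC0 hM hK hMK hW hU hWU ht hWt hUt
      (harmonic_mono (Submodule.finrank_mono hU.le_realSpan)) ?_
    exact ih (by rwa [div_div, ← pow_succ']) hU (half_pos ht) hUt' hUt

theorem exists_scaledDet_div_two_pow_le_one (hM : IsLattice M) (ht : 0 < t) :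
    ∃ j : ℕ, scaledDet M (t / 2 ^ j) W ≤ 1 := by
  rcases eq_or_ne W ⊥ with rfl | hW
  · exact ⟨0, scaledDet_bot.le⟩
  have ha := Real.rpow_pos_of_pos (det_pos (hM.inter_subspace W)) (-(1 / (finrank ℝ W : ℝ)))
  obtain ⟨j, hj⟩ := pow_unbounded_of_one_lt
    (t / det (inter M W) ^ (-(1 / (finrank ℝ W : ℝ)))) one_lt_two
  exact ⟨j, (scaledDet_le_one_iff hM (by positivity) hW).2
    ((div_lt_comm₀ ha (by positivity)).1 hj).le⟩

theorem IsCoveringConstant.covers_dual (hC : IsCoveringConstant n C) (hC0 : 0 ≤ C)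
    (hM : IsLattice M) (hK : 0 < K) (hMK : IsKLBound M K) :
    Covers (dual M) (2 * C * K * √(harmonic (finrank ℝ (realSpan M)))) := by
  obtain ⟨j, hj⟩ := exists_scaledDet_div_two_pow_le_one (W := realSpan M) hM hK
  have h := hC.covers_dual_proj_of_scaledDet_le_one hC0 hM hK.le hMK j hj (isLatticeSubspace_bot M)
    hK (by rw [proj_orthogonal_bot]; exact hMK.detLowerBound hM hK) scaledDet_bot.le
  rwa [proj_orthogonal_bot, finrank_bot, harmonic_zero, Rat.cast_zero, sub_zero] at h

end KannanLovasz

section ExtendedConstants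

variable {t : ℝ}

theorem ofReal_smoothingParameter_dual_le (hM : IsLattice M) (h0 : M ≠ ⊥) (ht : 0 < t)
    (hMt : DetLowerBound M t) :
    ENNReal.ofReal (smoothingParameter (dual M)) ≤ Ceta n * ENNReal.ofReal t := by
  have heta : etaDet (dual M) ≤ ENNReal.ofReal t := by
    refine iSup_le fun W => iSup_le fun hW => iSup_le fun hW0 => ?_
    rw [dual_dual hM] at hW ⊢
    exact ENNReal.ofReal_le_ofReal ((one_le_scaledDet_iff hM ht hW0).1 (hMt W hW))
  rw [← ENNReal.div_le_iff (ENNReal.ofReal_pos.2 ht).ne' ENNReal.ofReal_ne_top]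
  refine le_sInf fun C hC => ENNReal.div_le_of_le_mul ?_
  exact (hC (dual M) (isLattice_dual hM) (dual_ne_bot hM h0)).trans (by gcongr)

theorem isCoveringConstant_toReal_Ceta (hC : Ceta n ≠ ⊤) :
    IsCoveringConstant n (Ceta n).toReal := by
  intro N hN t ht hNt
  rcases eq_or_ne N ⊥ with rfl | h0
  · exact covers_dual_bot (by positivity)
  have hη := ofReal_smoothingParameter_dual_le hN h0 ht hNt
  rw [← ENNReal.ofReal_toReal hC, ← ENNReal.ofReal_mul ENNReal.toReal_nonneg,
    ENNReal.ofReal_le_ofReal_iff (by positivity)] at hη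
  have hcover := covers_smoothingParameter (isLattice_dual hN) (dual_ne_bot hN h0)
  rw [realSpan_dual hN] at hcover
  exact hcover.mono (by gcongr)

theorem detLowerBound_of_finrank_eq_one (hM : IsLattice M) (h1 : finrank ℝ (realSpan M) = 1) :
    DetLowerBound M (det M)⁻¹ := by
  intro W hW
  rcases eq_or_ne W ⊥ with rfl | hW0
  · exact scaledDet_bot.ge
  have hWM : W = realSpan M := Submodule.eq_of_le_of_finrank_le hW.le_realSpan
    (h1.trans_le (Submodule.one_le_finrank_iff.2 hW0))
  rw [hWM, scaledDet, h1, inter_realSpan, pow_one, inv_mul_cancel₀ (det_pos hM).ne']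

theorem isBasis_span_singleton {x : Space n} (hx : x ≠ 0) :
    IsBasis (Submodule.span ℤ {x}) fun _ : Fin 1 => x :=
  ⟨linearIndependent_unique_iff.2 hx, by rw [Set.range_const]⟩

theorem Ceta_ne_zero (hn : n ≠ 0) : Ceta n ≠ 0 := by
  have : NeZero n := ⟨hn⟩
  have he : (EuclideanSpace.single 0 1 : Space n) ≠ 0 := by simp
  have hb := isBasis_span_singleton he
  have hM : IsLattice _ := ⟨1, _, hb⟩
  have h0 := (Submodule.span_singleton_eq_bot (R := ℤ)).not.2 he
  have hη := ofReal_smoothingParameter_dual_le hM h0 (inv_pos.2 (det_pos hM))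
    (detLowerBound_of_finrank_eq_one hM hb.finrank_eq)
  have hpos := (smoothingParameter_spec (isLattice_dual hM) (dual_ne_bot hM h0)).1
  intro hC
  rw [hC, zero_mul, nonpos_iff_eq_zero, ENNReal.ofReal_eq_zero] at hη
  exact hη.not_gt hpos

theorem muDet_ne_zero (hL : IsLattice L) (h0 : L ≠ ⊥) : muDet L ≠ 0 := by
  have hd : 1 ≤ finrank ℝ (realSpan (dual L)) :=
    Submodule.one_le_finrank_iff.2 (realSpan_eq_bot_iff.not.2 (dual_ne_bot hL h0))
  have hdet := det_pos ((isLattice_dual hL).inter_subspace (realSpan (dual L)))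
  rw [← pos_iff_ne_zero, muDet]
  refine lt_of_lt_of_le ?_ (le_iSup₂_of_le (realSpan (dual L)) (isLatticeSubspace_realSpan _)
    (le_iSup_of_le hd le_rfl))
  exact ENNReal.ofReal_pos.2 (by positivity)

theorem isKLBound_toReal_muDet (hμ : muDet L ≠ ⊤) : IsKLBound (dual L) (muDet L).toReal := by
  intro W hW hd
  rw [← ENNReal.ofReal_le_iff_le_toReal hμ]
  exact le_iSup₂_of_le W hW (le_iSup_of_le hd le_rfl)

theorem harmonic_finrank_le (W : Submodule ℝ (Space n)) :
    (harmonic (finrank ℝ W) : ℝ) ≤ 1 + Real.log n := by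
  have hle : finrank ℝ W ≤ n := by simpa using Submodule.finrank_le W
  exact (Rat.cast_le.2 (harmonic_mono hle)).trans (harmonic_le_one_add_log n)

theorem coveringRadius_le_of_ne_top (hL : IsLattice L) (h0 : L ≠ ⊥) (hC : Ceta n ≠ ⊤)
    (hμ : muDet L ≠ ⊤) :
    coveringRadius L ≤ 2 * √(1 + Real.log n) * (Ceta n).toReal * (muDet L).toReal := by
  have hcover := (isCoveringConstant_toReal_Ceta hC).covers_dual ENNReal.toReal_nonneg
    (isLattice_dual hL) (ENNReal.toReal_pos (muDet_ne_zero hL h0) hμ) (isKLBound_toReal_muDet hμ)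
  rw [dual_dual hL] at hcover
  calc coveringRadius L
      ≤ 2 * (Ceta n).toReal * (muDet L).toReal * √(harmonic (finrank ℝ (realSpan (dual L)))) :=
        coveringRadius_le (by positivity) hcover
    _ ≤ 2 * (Ceta n).toReal * (muDet L).toReal * √(1 + Real.log n) := by
        gcongr
        exact harmonic_finrank_le _
    _ = 2 * √(1 + Real.log n) * (Ceta n).toReal * (muDet L).toReal := by ring

theorem ofReal_coveringRadius_le (hL : IsLattice L) (h0 : L ≠ ⊥) :
    ENNReal.ofReal (coveringRadius L) ≤
      ENNReal.ofReal (2 * √(1 + Real.log n)) * Ceta n * muDet L := by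
  have hn : n ≠ 0 := by
    rintro rfl
    exact h0 (Subsingleton.elim _ _)
  have hlog : ENNReal.ofReal (2 * √(1 + Real.log n)) ≠ 0 :=
    (ENNReal.ofReal_pos.2 (by have := Real.log_natCast_nonneg n; positivity)).ne'
  rcases eq_or_ne (Ceta n) ⊤ with hC | hC
  · rw [hC, ENNReal.mul_top hlog, ENNReal.top_mul (muDet_ne_zero hL h0)]
    exact le_top
  rcases eq_or_ne (muDet L) ⊤ with hμ | hμ
  · rw [hμ, ENNReal.mul_top (mul_ne_zero hlog (Ceta_ne_zero hn))]
    exact le_top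
  rw [← ENNReal.ofReal_toReal hC, ← ENNReal.ofReal_toReal hμ,
    ← ENNReal.ofReal_mul (by positivity), ← ENNReal.ofReal_mul (by positivity)]
  exact ENNReal.ofReal_le_ofReal (coveringRadius_le_of_ne_top hL h0 hC hμ)

theorem PolylogBounded.of_le_log_mul {F G : ℕ → ℝ≥0∞} {c : ℝ} (hc : 0 ≤ c)
    (h : ∀ n : ℕ, 2 ≤ n → F n ≤ ENNReal.ofReal (c * Real.log n) * G n) (hG : PolylogBounded G) :
    PolylogBounded F := by
  obtain ⟨p, hp⟩ := hG
  refine ⟨Polynomial.C c * Polynomial.X * p, fun n hn => (h n hn).trans ?_⟩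
  rw [Polynomial.eval_mul, Polynomial.eval_mul, Polynomial.eval_C, Polynomial.eval_X,
    ENNReal.ofReal_mul (mul_nonneg hc (Real.log_natCast_nonneg n))]
  gcongr
  exact hp n hn

theorem two_mul_sqrt_one_add_log_le (hn : 2 ≤ n) :
    2 * √(1 + Real.log n) ≤ 4 * Real.log n := by
  have hlog : Real.log 2 ≤ Real.log n := Real.log_le_log two_pos (by exact_mod_cast hn)
  have hlog_two := Real.log_two_gt_d9
  have hsqrt : √(1 + Real.log n) ≤ 2 * Real.log n :=
    Real.sqrt_le_iff.2 ⟨by linarith, by nlinarith⟩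
  linarith

end ExtendedConstants

end EuclideanLattice

end

open EuclideanLattice in
theorem mainTheorem1_general (n : ℕ) :
    CKL n ≤ ENNReal.ofReal (2 * √(1 + Real.log n)) * Ceta n ∧
      ∀ L : Submodule ℤ (Space n), IsLattice L → L ≠ ⊥ →
        ENNReal.ofReal (coveringRadius L) ≤
          ENNReal.ofReal (2 * √(1 + Real.log n)) * Ceta n * muDet L :=
  have hbound := fun (L : Submodule ℤ (Space n)) hL h0 => ofReal_coveringRadius_le (L := L) hL h0
  ⟨sInf_le hbound, hbound⟩

theorem mainTheorem1 :
    (∃ c : ℝ, 0 < c ∧ ∀ n : ℕ, 2 ≤ n →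
      EuclideanLattice.CKL n ≤ ENNReal.ofReal (c * Real.log n) * EuclideanLattice.Ceta n ∧
      ∀ L : Submodule ℤ (EuclideanLattice.Space n),
        EuclideanLattice.IsLattice L → L ≠ ⊥ →
        ENNReal.ofReal (EuclideanLattice.coveringRadius L) ≤
          ENNReal.ofReal (c * Real.log n) * EuclideanLattice.Ceta n *
            EuclideanLattice.muDet L) ∧
    (EuclideanLattice.PolylogBounded EuclideanLattice.Ceta →
      EuclideanLattice.PolylogBounded EuclideanLattice.CKL) := by
  have hlog (n : ℕ) (hn : 2 ≤ n) := ENNReal.ofReal_le_ofReal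
    (EuclideanLattice.two_mul_sqrt_one_add_log_le hn)
  have hCKL (n : ℕ) (hn : 2 ≤ n) :=
    (mainTheorem1_general n).1.trans (mul_le_mul_left (hlog n hn) _)
  refine ⟨⟨4, four_pos, fun n hn => ⟨hCKL n hn, fun L hL h0 => ?_⟩⟩,
    EuclideanLattice.PolylogBounded.of_le_log_mul zero_le_four hCKL⟩
  exact ((mainTheorem1_general n).2 L hL h0).trans
    (mul_le_mul_left (mul_le_mul_left (hlog n hn) _) _)
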